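/- For a real number $x \geq 1$, an integer $q \geq 1$ and $a \in (\mathbb{Z}/q\mathbb{Z})^{\times}$, let $$S(x;q,a) = \sum_{\substack{1 \leq n \leq x \\ n \equiv a \ (\mathrm{mod}\ q)}} |\mu(n)|$$ be the number of squarefree positive integers up to $x$ congruent to $a$ modulo $q$, where $\mu$ is the Möbius function, and define $E(x;q,a)$ by $$S(x;q,a) = c_q \frac{x}{q} + E(x;q,a), \qquad c_q = \prod_{p \nmid q} \left( 1 - \frac{1}{p^2} \right),$$ the product being over the primes $p$ not dividing $q$. Let $\varepsilon > 0$ be fixed. Then there is a constant $C > 0$ depending only on $\varepsilon$ such that for every real $x \geq 1$ and every integer $q \geq 1$ with $q \leq x^{1/2}$, $$\frac{1}{\varphi(q)} \, \# \left\{ a \in (\mathbb{Z}/q\mathbb{Z})^{\times} : |E(x;q,a)| > \frac{x^{1/2+\varepsilon}}{q^{3/4}} \right\} \leq C x^{-\varepsilon},$$ where $\varphi$ is Euler's totient function. -/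

import Mathlib

namespace SquarefreeAP

/-- The number of squarefree `1 ≤ n ≤ x` in the residue class `a` modulo `q`,
written as the sum of `|μ(n)|`. -/
noncomputable def S (x : ℝ) (q : ℕ) (a : ZMod q) : ℝ :=
  ∑ n ∈ (Finset.Icc 1 ⌊x⌋₊).filter (fun n : ℕ => (n : ZMod q) = a),
    |(ArithmeticFunction.moebius n : ℝ)|

/-- The constant `c_q`, the product of `1 - 1 / p ^ 2` over the primes `p` not dividing `q`. -/
noncomputable def c (q : ℕ) : ℝ :=
  ∏' p : {p : ℕ // p.Prime ∧ ¬ p ∣ q}, (1 - 1 / ((p : ℕ) : ℝ) ^ 2)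

/-- The product defining `c q` converges. -/
theorem multipliable_c (q : ℕ) :
    Multipliable (fun p : {p : ℕ // p.Prime ∧ ¬ p ∣ q} => 1 - 1 / ((p : ℕ) : ℝ) ^ 2) := by
  have h : Summable (fun n : ℕ => 1 / (n : ℝ) ^ 2) :=
    Real.summable_one_div_nat_pow.mpr one_lt_two
  have h2 : Summable
      (fun p : {p : ℕ // p.Prime ∧ ¬ p ∣ q} => ‖-(1 / ((p : ℕ) : ℝ) ^ 2)‖) := by
    simpa [Function.comp_def] using h.comp_injective
      (Subtype.val_injective (p := fun p : ℕ => p.Prime ∧ ¬ p ∣ q))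
  simpa [sub_eq_add_neg] using multipliable_one_add_of_summable h2

/-- The error term `E(x; q, a)`, defined by `S(x; q, a) = c_q x / q + E(x; q, a)`. -/
noncomputable def E (x : ℝ) (q : ℕ) (a : ZMod q) : ℝ :=
  S x q a - c q * (x / q)

end SquarefreeAP

/-! Put `V = x / √q`. The threshold `T` satisfies `q T² = x^(2ε) V`, so by Chebyshev's inequality it
suffices to bound the variance of `E` over reduced classes by `V` up to powers of `log x` and `τ(q)`
(`variance_le`); these powers, and the loss from `φ(q)` against `q`, cost at most `x^ε`.

Write `|μ(n)| = ∑ μ(d)` over `d² ∣ n` and cut at `D = ⌊√V⌋`. For `d > D` the second moment over `a`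
counts coincidences `m₁ d₁² ≡ m₂ d₂²` modulo `q`. For `d ≤ D` the number of `m` is centred and
Parseval passes to frequencies `r ≠ 0`, where the sum over `m` is at most `min(X/d², q/|k|)` with
`k` the least absolute residue of `r d²`. Eliminating `r` between `k₁ ≡ r d₁²` and `k₂ ≡ r d₂²`
leaves `k₁ d₂² ≡ k₂ d₁²`, the same congruence.

After dyadic decomposition everything rests on `card_quad_le`: with `|kᵢ| ≤ K` and `dᵢ ≤ N` that
congruence has at most about `KN + K²N²/q` solutions. Common factors are divided out first. Fixing
the `d`'s puts `(k₁, k₂)` in a lattice of determinant `q`; fixing the `k`'s fixes `d₂/d₁` up to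
`O(τ(q))` square roots and puts `(d₁, d₂)` in such a lattice. Primitive lattice points in a box are
few because their slopes are well spaced, and fixing the shorter variables costs `min(K, N)² ≤ KN`.
-/

namespace SquarefreeAP

open Finset

/-! ### Square roots modulo `n` and divisor bounds -/

/-- The solutions of `ρ ^ 2 = 1` modulo `n` number at most `2 τ(n)`. -/
theorem card_sq_eq_one_le (n : ℕ) [NeZero n] :
    #{ρ : ZMod n | ρ ^ 2 = 1} ≤ 2 * #n.divisors := by
  classical
  have hn : n ≠ 0 := NeZero.ne n
  -- Each fibre of `ρ ↦ g = gcd(ρ - 1, n)` has at most two elements: there `g ∣ ρ - 1` and `n/g ∣ ρ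
  -- + 1`, which forces `n ∣ 2(s - t)` for any two roots `s, t`, and three distinct residues cannot
  -- pairwise differ by `n/2`.
  let f : ZMod n → ℕ := fun ρ => Int.gcd ((ρ.val : ℤ) - 1) n
  have hdvd : ∀ ρ : ZMod n, ρ ^ 2 = 1 → (n : ℤ) ∣ ((ρ.val : ℤ) - 1) * (ρ.val + 1) := by
    intro ρ h
    rw [← ZMod.intCast_zmod_eq_zero_iff_dvd]
    push_cast
    rw [ZMod.natCast_zmod_val]
    linear_combination h
  have hco : ∀ ρ : ZMod n, ρ ^ 2 = 1 → ((n / f ρ : ℕ) : ℤ) ∣ (ρ.val : ℤ) + 1 := by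
    intro ρ h
    have hg : f ρ ∣ n := by exact_mod_cast Int.gcd_dvd_right ((ρ.val : ℤ) - 1) n
    have hg0 : 0 < f ρ := Nat.pos_of_dvd_of_pos hg (Nat.pos_of_ne_zero hn)
    have hc : IsCoprime (((ρ.val : ℤ) - 1) / (f ρ : ℕ)) ((n : ℤ) / (f ρ : ℕ)) := by
      rw [Int.isCoprime_iff_gcd_eq_one]
      exact Int.gcd_div_gcd_div_gcd hg0
    obtain ⟨u, hu⟩ : ((f ρ : ℕ) : ℤ) ∣ (ρ.val : ℤ) - 1 := Int.gcd_dvd_left ..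
    obtain ⟨v, hv⟩ := hg
    have hf0 : ((f ρ : ℕ) : ℤ) ≠ 0 := by exact_mod_cast hg0.ne'
    have hv' : n / f ρ = v := by
      conv_lhs => rw [hv]
      exact Nat.mul_div_cancel_left _ hg0
    have hvz : (n : ℤ) / (f ρ : ℕ) = v := by rw [← hv']; push_cast; rfl
    rw [hvz, hu, Int.mul_ediv_cancel_left _ hf0] at hc
    rw [hv']
    have h2 := hdvd ρ h
    rw [hu, mul_assoc] at h2
    have h3 : ((f ρ : ℕ) : ℤ) * v ∣ (f ρ : ℕ) * (u * (ρ.val + 1)) := by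
      have : (n : ℤ) = (f ρ : ℕ) * v := by exact_mod_cast hv
      rwa [← this]
    exact hc.symm.dvd_of_dvd_mul_left (Int.dvd_of_mul_dvd_mul_left hf0 h3)
  have hmaps : ∀ ρ ∈ ({ρ : ZMod n | ρ ^ 2 = 1} : Finset (ZMod n)), f ρ ∈ n.divisors := by
    intro ρ _
    rw [Nat.mem_divisors]
    exact ⟨by exact_mod_cast Int.gcd_dvd_right ((ρ.val : ℤ) - 1) n, hn⟩
  rw [mul_comm]
  refine card_le_mul_card_image_of_maps_to hmaps 2 ?_ |>.trans (by rw [mul_comm])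
  intro g hg
  by_contra! hlt
  obtain ⟨a, b, c, ha, hb, hc, hab, hac, hbc⟩ := two_lt_card_iff.mp hlt
  simp only [mem_filter, mem_univ, true_and] at ha hb hc
  have key : ∀ s t : ZMod n, (s ^ 2 = 1 ∧ f s = g) → (t ^ 2 = 1 ∧ f t = g) →
      (n : ℤ) ∣ 2 * ((s.val : ℤ) - t.val) := by
    intro s t hs ht
    have hgn := (Nat.mem_divisors.mp hg).1
    obtain ⟨v, hv⟩ := hgn
    have hg0 : 0 < g := Nat.pos_of_mem_divisors hg
    have hv' : n / g = v := by rw [hv, Nat.mul_div_cancel_left _ hg0]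
    have h1 : (g : ℤ) ∣ (s.val : ℤ) - 1 := by rw [← hs.2]; exact Int.gcd_dvd_left ..
    have h2 : (g : ℤ) ∣ (t.val : ℤ) - 1 := by rw [← ht.2]; exact Int.gcd_dvd_left ..
    have h3 := hco s hs.1
    have h4 := hco t ht.1
    rw [hs.2, hv'] at h3
    rw [ht.2, hv'] at h4
    have e : 2 * ((s.val : ℤ) - t.val) = (s.val - 1) * (t.val + 1)
      - (t.val - 1) * (s.val + 1) := by ring
    have : (n : ℤ) = g * v := by exact_mod_cast hv
    rw [e, this]
    exact dvd_sub (mul_dvd_mul h1 h4) (mul_dvd_mul h2 h3)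
  have val_ne : ∀ s t : ZMod n, s ≠ t → s.val ≠ t.val := fun s t h h' => h (ZMod.val_injective n h')
  have h1 := key a b ha hb
  have h2 := key a c ha hc
  have h3 := key b c hb hc
  have := val_ne _ _ hab
  have := val_ne _ _ hac
  have := val_ne _ _ hbc
  have la := a.val_lt
  have lb := b.val_lt
  have lc := c.val_lt
  have aux : ∀ z : ℤ, (n : ℤ) ∣ 2 * z → -n < z → z < n → z = 0 ∨ 2 * z = n ∨ 2 * z = -n := by
    intro z ⟨k, hk⟩ h1 h2
    have hnp : (0 : ℤ) < n := by positivity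
    have : k < 2 := by nlinarith
    have : -2 < k := by nlinarith
    have : k = -1 ∨ k = 0 ∨ k = 1 := by lia
    rcases this with rfl | rfl | rfl <;> lia
  have := aux _ h1 (by lia) (by lia)
  have := aux _ h2 (by lia) (by lia)
  have := aux _ h3 (by lia) (by lia)
  lia

/-- The square roots of a unit modulo `n` number at most `2 τ(n)`. -/
theorem card_unit_sq_eq_le (n : ℕ) [NeZero n] (s : Finset (ZMod n)) (c : ZMod n)
    (hs : ∀ ρ ∈ s, IsUnit ρ ∧ ρ ^ 2 = c) : #s ≤ 2 * #n.divisors := by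
  rcases s.eq_empty_or_nonempty with rfl | ⟨ρ₀, h₀⟩
  · simp
  obtain ⟨u, hu⟩ := (hs ρ₀ h₀).1
  refine le_trans (card_le_card_of_injOn (fun ρ => ρ * (↑u⁻¹ : ZMod n)) ?_ ?_)
    (card_sq_eq_one_le n)
  · intro ρ hρ
    have h1 := (hs ρ hρ).2
    have h2 := (hs ρ₀ h₀).2
    simp only [coe_filter, mem_univ, true_and, Set.mem_ofPred_eq]
    rw [mul_pow, h1, ← h2, ← hu, ← mul_pow, Units.mul_inv, one_pow]
  · intro a _ b _ h
    simpa using h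

/-- Prime by prime this is `p ≤ (p - 1)(k + 1)` for `k ≥ 1`. It trades `q` for `φ(q)` at the price
of one divisor function. -/
theorem le_totient_mul_card_divisors (n : ℕ) : n ≤ n.totient * #n.divisors := by
  rcases eq_or_ne n 0 with rfl | hn
  · simp
  conv_lhs => rw [← Nat.prod_factorization_pow_eq_self hn]
  rw [Nat.totient_eq_prod_factorization hn, Nat.card_divisors hn]
  simp only [Finsupp.prod, Nat.support_factorization]
  rw [← prod_mul_distrib]
  refine prod_le_prod' fun p hp => ?_
  have hpp := Nat.prime_of_mem_primeFactors hp
  have hpos : 0 < n.factorization p :=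
    hpp.factorization_pos_of_dvd hn (Nat.dvd_of_mem_primeFactors hp)
  obtain ⟨k, hk⟩ := Nat.exists_eq_succ_of_ne_zero hpos.ne'
  have h2 := hpp.two_le
  rw [hk, Nat.succ_sub_one, Nat.pow_succ, mul_assoc]
  refine Nat.mul_le_mul_left _ ?_
  obtain ⟨m, rfl⟩ := Nat.exists_eq_add_of_le h2
  have : 2 + m - 1 = m + 1 := by lia
  rw [this]
  nlinarith

/-- The divisor bound `τ(n) ≪ n ^ δ`. -/
theorem card_divisors_le_rpow (δ : ℝ) (hδ : 0 < δ) :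
    ∃ C : ℝ, 0 < C ∧ ∀ n : ℕ, n ≠ 0 → (#n.divisors : ℝ) ≤ C * (n : ℝ) ^ δ := by
  -- Local factors: if `p ≥ P` then `p^δ ≥ 2` and `a + 1 ≤ 2^a ≤ p^(aδ)`. For smaller `p`, `2^(aδ) ≥
  -- 1 + aδ log 2`, and `B` is chosen so that `B` times this is at least `a + 1`. At most `P` primes
  -- pay the factor `B`.
  set B : ℝ := 1 + 1 / (δ * Real.log 2) with hB
  have hl2 : 0 < Real.log 2 := Real.log_pos one_lt_two
  have hB1 : 1 ≤ B := by rw [hB]; linarith [show 0 < 1 / (δ * Real.log 2) by positivity]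
  set P : ℕ := ⌈(2 : ℝ) ^ (1 / δ)⌉₊ with hP
  refine ⟨B ^ P, by positivity, fun n hn => ?_⟩
  have key : ∀ p ∈ n.primeFactors, ((n.factorization p + 1 : ℕ) : ℝ) ≤
      (if p < P then B else 1) * ((p : ℝ) ^ (n.factorization p)) ^ δ := by
    intro p hp
    have hpp := Nat.prime_of_mem_primeFactors hp
    have h2 : (2 : ℝ) ≤ p := by exact_mod_cast hpp.two_le
    set a := n.factorization p
    split_ifs with h
    · have h1 : ((2 : ℝ) ^ a) ^ δ ≤ ((p : ℝ) ^ a) ^ δ := by gcongr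
      have h3 : 1 + (a * δ) * Real.log 2 ≤ ((2 : ℝ) ^ a) ^ δ := by
        rw [← Real.rpow_natCast, ← Real.rpow_mul (by norm_num),
          Real.rpow_def_of_pos (by norm_num)]
        have := Real.add_one_le_exp (Real.log 2 * (a * δ))
        linarith
      have h4 : ((a + 1 : ℕ) : ℝ) ≤ B * (1 + (a * δ) * Real.log 2) := by
        have e : B * (1 + (a * δ) * Real.log 2) =
            1 + a + (a * δ) * Real.log 2 + 1 / (δ * Real.log 2) := by
          rw [hB]; field_simp; ring
        rw [e]
        have : 0 ≤ (a * δ) * Real.log 2 := by positivity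
        have : 0 < 1 / (δ * Real.log 2) := by positivity
        push_cast; linarith
      exact h4.trans (by gcongr; linarith)
    · have h1 : (2 : ℝ) ^ (1 / δ) ≤ p := (Nat.le_ceil _).trans (by exact_mod_cast not_lt.mp h)
      have h3 : (2 : ℝ) ≤ (p : ℝ) ^ δ := by
        calc (2 : ℝ) = ((2 : ℝ) ^ (1 / δ)) ^ δ := by
              rw [← Real.rpow_mul (by norm_num), one_div_mul_cancel hδ.ne', Real.rpow_one]
          _ ≤ _ := by gcongr
      have h4 : ((p : ℝ) ^ a) ^ δ = ((p : ℝ) ^ δ) ^ a := by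
        rw [← Real.rpow_natCast, ← Real.rpow_natCast, ← Real.rpow_mul (by positivity),
          ← Real.rpow_mul (by positivity), mul_comm]
      rw [h4, one_mul]
      calc ((a + 1 : ℕ) : ℝ) ≤ (2 : ℝ) ^ a := by exact_mod_cast a.lt_two_pow_self
        _ ≤ _ := by gcongr
  rw [Nat.card_divisors hn]
  push_cast
  calc ∏ x ∈ n.primeFactors, ((n.factorization x : ℝ) + 1)
      ≤ ∏ p ∈ n.primeFactors,
        ((if p < P then B else 1) * ((p : ℝ) ^ (n.factorization p)) ^ δ) :=
        prod_le_prod (fun _ _ => by positivity) (fun p hp => by exact_mod_cast key p hp)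
    _ = (∏ p ∈ n.primeFactors, (if p < P then B else 1)) * (n : ℝ) ^ δ := by
        rw [prod_mul_distrib, Real.finsetProd_rpow _ _ (fun _ _ => by positivity)]
        congr 2
        conv_rhs => rw [← Nat.prod_factorization_pow_eq_self hn]
        simp [Finsupp.prod]
    _ ≤ _ := by
        gcongr
        rw [← prod_filter, prod_const]
        refine pow_le_pow_right₀ hB1 ?_
        calc #{p ∈ n.primeFactors | p < P} ≤ #(range P) :=
              card_le_card fun p hp => by simp at hp ⊢; exact hp.2
          _ = P := card_range P

/-! ### Möbius expansion of the squarefree indicator and the series for `c q` -/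

/-- `|μ(n)|` as a sum of `μ` over the square divisors of `n`. -/
theorem abs_moebius_eq_sum (n : ℕ) (hn : n ≠ 0) (s : Finset ℕ)
    (hs : ∀ d, d ^ 2 ∣ n → d ∈ s) :
    |(ArithmeticFunction.moebius n : ℝ)| =
      ∑ d ∈ s with d ^ 2 ∣ n, (ArithmeticFunction.moebius d : ℝ) := by
  obtain ⟨b, a, hb, ha, hab, hsq⟩ := Nat.sq_mul_squarefree_of_pos (Nat.pos_of_ne_zero hn)
  -- With `n = a² b` and `b` squarefree, `d² ∣ n` exactly when `d ∣ a`; then `∑ μ(d)` over `d ∣ a`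
  -- detects `a = 1`, that is, `n` squarefree.
  have hset : s.filter (fun d => d ^ 2 ∣ n) = a.divisors := by
    ext d
    simp only [mem_filter, Nat.mem_divisors]
    constructor
    · rintro ⟨-, h⟩
      refine ⟨?_, ha.ne'⟩
      have hd : d ≠ 0 := by
        rintro rfl
        exact hn (by simpa using h)
      rw [← Nat.factorization_le_iff_dvd hd ha.ne']
      intro p
      rw [← Nat.factorization_le_iff_dvd (pow_ne_zero 2 hd) hn, ← hab] at h
      have h1 := h p
      rw [Nat.factorization_mul (pow_ne_zero 2 ha.ne') hb.ne', Finsupp.add_apply,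
        Nat.factorization_pow, Nat.factorization_pow] at h1
      simp only [Finsupp.smul_apply, smul_eq_mul] at h1
      have := hsq.natFactorization_le_one p
      lia
    · rintro ⟨h, -⟩
      have : d ^ 2 ∣ n := hab ▸ (pow_dvd_pow_of_dvd h 2).mul_right b
      exact ⟨hs d this, this⟩
  have hone : ∑ d ∈ a.divisors, (ArithmeticFunction.moebius d : ℝ) = if a = 1 then 1 else 0 := by
    have := congrArg (fun f => f a) (ArithmeticFunction.coe_moebius_mul_coe_zeta (R := ℝ))
    simp only [ArithmeticFunction.coe_mul_zeta_apply, ArithmeticFunction.one_apply] at this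
    simpa using this
  rw [hset, hone]
  split_ifs with h
  · subst h
    have : Squarefree n := by rw [← hab]; simpa using hsq
    have := ArithmeticFunction.abs_moebius_eq_one_of_squarefree this
    exact_mod_cast this
  · have : ¬ Squarefree n := fun hh => h (by
      have := hh a (by rw [← hab, sq]; exact Dvd.intro _ rfl)
      simpa using this)
    rw [ArithmeticFunction.moebius_eq_zero_of_not_squarefree this]
    simp

/-- The series `∑ μ(d) / d ^ 2` over `d` coprime to `q`, converging to `c q`. -/
theorem hasSum_c (q : ℕ) :
    HasSum (fun d : ℕ => if d.Coprime q then (ArithmeticFunction.moebius d : ℝ) / (d : ℝ) ^ 2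
      else 0) (c q) := by
  set f : ℕ → ℝ := fun d => if d.Coprime q then (ArithmeticFunction.moebius d : ℝ) / (d : ℝ) ^ 2
    else 0 with hf
  have hbound : ∀ d, ‖f d‖ ≤ 1 / (d : ℝ) ^ 2 := by
    intro d
    simp only [hf]
    split_ifs
    · rw [norm_div, norm_pow, Real.norm_natCast, Real.norm_eq_abs]
      gcongr
      exact_mod_cast ArithmeticFunction.abs_moebius_le_one
    · rw [norm_zero]; positivity
  have hsum : Summable (‖f ·‖) := Summable.of_nonneg_of_le (fun _ => norm_nonneg _) hbound
    (Real.summable_one_div_nat_pow.mpr one_lt_two)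
  have hf1 : f 1 = 1 := by simp [hf]
  have hf0 : f 0 = 0 := by simp [hf]
  have hmul : ∀ {m n : ℕ}, m.Coprime n → f (m * n) = f m * f n := by
    intro m n hmn
    simp only [hf, Nat.coprime_mul_iff_left]
    rw [ArithmeticFunction.isMultiplicative_moebius.map_mul_of_coprime hmn]
    split_ifs <;> first | tauto | simp
    field_simp
  -- Euler product; `μ` vanishes on `p^e` for `e ≥ 2`, so each local factor has only two terms.
  have hprod := EulerProduct.eulerProduct_hasProd_mulIndicator hf1 hmul hsum hf0
  have hlocal : ∀ p : ℕ, p.Prime →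
      ∑' e, f (p ^ e) = if p ∣ q then 1 else 1 - 1 / (p : ℝ) ^ 2 := by
    intro p hp
    rw [tsum_eq_sum (s := range 2)]
    · rw [sum_range_succ, sum_range_one, pow_zero, hf1, pow_one]
      simp only [hf, hp.coprime_iff_not_dvd, ArithmeticFunction.moebius_apply_prime hp]
      split_ifs <;> push_cast <;> first | contradiction | ring
    · intro e he
      simp only [mem_range, not_lt] at he
      have : ArithmeticFunction.moebius (p ^ e) = 0 := by
        rw [ArithmeticFunction.moebius_apply_prime_pow hp (by lia), if_neg (by lia)]
      simp [hf, this]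
  have hfun : Set.mulIndicator {p | Nat.Prime p} (fun p ↦ ∑' e, f (p ^ e)) =
      Set.mulIndicator {p : ℕ | p.Prime ∧ ¬ p ∣ q} (fun p => 1 - 1 / (p : ℝ) ^ 2) := by
    ext p
    by_cases hp : p.Prime
    · by_cases hd : p ∣ q <;> simp [Set.mulIndicator, hp, hd, hlocal p hp]
    · simp [Set.mulIndicator, hp]
  rw [hfun, ← hasProd_subtype_iff_mulIndicator] at hprod
  have : c q = ∑' d, f d := hprod.tprod_eq
  rw [this]
  exact hsum.of_norm.hasSum

/-! ### Primitive lattice points in a box -/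

/-- Two different slopes `p.2 / p.1` differ by a nonzero determinant over `p.1 p'.1`, hence by at
least `n / Δ² = 1 / Y`. The slopes lie in `[-1, 1]`, so multiplying by `Y` and taking floors
separates them into at most `2Y + 2` cells. A primitive point is determined by its slope and the
sign of its first coordinate, whence another factor `2`. -/
theorem card_lattice_half_le (n Δ : ℕ) (hn : 0 < n) (P : Finset (ℤ × ℤ))
    (h : ∀ p ∈ P, p.1 ≠ 0 ∧ |p.1| ≤ Δ ∧ |p.2| ≤ |p.1| ∧ IsCoprime p.1 p.2)
    (hd : ∀ p ∈ P, ∀ p' ∈ P, (n : ℤ) ∣ p.1 * p'.2 - p'.1 * p.2) :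
    (#P : ℝ) ≤ 4 * ((Δ : ℝ) ^ 2 / n + 1) := by
  have hn' : (0 : ℝ) < n := by exact_mod_cast hn
  set Y : ℝ := (Δ : ℝ) ^ 2 / n with hY
  have hY0 : 0 ≤ Y := by positivity
  let F : ℤ × ℤ → Bool × ℤ := fun p => (decide (0 < p.1), ⌊(p.2 : ℝ) / p.1 * Y⌋)
  have hmaps : ∀ p ∈ P, F p ∈ (univ : Finset Bool) ×ˢ Icc ⌊-Y⌋ ⌊Y⌋ := by
    intro p hp
    obtain ⟨h0, h1, h2, -⟩ := h p hp
    have hs : |(p.2 : ℝ) / p.1| ≤ 1 := by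
      rw [abs_div]
      exact div_le_one_of_le₀ (by exact_mod_cast h2) (abs_nonneg _)
    have hs' := abs_le.mp hs
    simp only [F, mem_product, mem_univ, true_and, mem_Icc]
    constructor <;> apply Int.floor_le_floor <;> nlinarith
  have hinj : Set.InjOn F P := by
    intro p hp p' hp' heq
    obtain ⟨h0, h1, h2, h3⟩ := h p hp
    obtain ⟨h0', h1', h2', h3'⟩ := h p' hp'
    simp only [F, Prod.mk.injEq, decide_eq_decide] at heq
    obtain ⟨hsgn, hfl⟩ := heq
    have hlt := Int.abs_sub_lt_one_of_floor_eq_floor hfl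
    have hu : (p.1 : ℝ) ≠ 0 := by exact_mod_cast h0
    have hu' : (p'.1 : ℝ) ≠ 0 := by exact_mod_cast h0'
    have hΔ : (0 : ℝ) < Δ := by
      have : 0 < |p.1| := abs_pos.mpr h0
      have : (0 : ℤ) < Δ := by lia
      exact_mod_cast this
    have hdet : p.1 * p'.2 - p'.1 * p.2 = 0 := by
      apply Int.eq_zero_of_abs_lt_dvd (hd p hp p' hp')
      have e : (p.2 : ℝ) / p.1 * Y - p'.2 / p'.1 * Y =
          -((p.1 * p'.2 - p'.1 * p.2 : ℤ) : ℝ) / (p.1 * p'.1) * Y := by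
        push_cast; field_simp; ring
      rw [e, abs_mul, abs_div, abs_neg, abs_mul, abs_of_nonneg hY0] at hlt
      have a1 : |(p.1 : ℝ)| ≤ Δ := by exact_mod_cast h1
      have a2 : |(p'.1 : ℝ)| ≤ Δ := by exact_mod_cast h1'
      have a3 : |(p.1 : ℝ)| * |(p'.1 : ℝ)| ≤ Δ ^ 2 := by
        rw [sq]; gcongr
      have a4 : 0 < |(p.1 : ℝ)| * |(p'.1 : ℝ)| := by positivity
      set T : ℝ := |((p.1 * p'.2 - p'.1 * p.2 : ℤ) : ℝ)| with hT
      have : T < n := by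
        have b1 : T / Δ ^ 2 * Y ≤ T / (|(p.1 : ℝ)| * |(p'.1 : ℝ)|) * Y := by gcongr
        have b2 : T / Δ ^ 2 * Y = T / n := by rw [hY]; field_simp
        rw [b2] at b1
        exact (div_lt_one hn').mp (b1.trans_lt hlt)
      rw [hT] at this
      exact_mod_cast this
    have d1 : p.1 ∣ p'.1 := h3.dvd_of_dvd_mul_right (Dvd.intro p'.2 (by lia))
    have d2 : p'.1 ∣ p.1 := h3'.dvd_of_dvd_mul_right (Dvd.intro p.2 (by lia))
    have e1 : p.1 = p'.1 := by
      rcases Int.natAbs_eq_natAbs_iff.mp (Nat.dvd_antisymm (Int.natAbs_dvd_natAbs.mpr d1)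
        (Int.natAbs_dvd_natAbs.mpr d2)) with h | h
      · exact h
      · lia
    refine Prod.ext e1 ?_
    rw [← e1] at hdet
    have : p.1 * (p'.2 - p.2) = 0 := by linarith
    have := (mul_eq_zero.mp this).resolve_left h0
    lia
  have hcard := card_le_card_of_injOn F hmaps hinj
  rw [card_product, Int.card_Icc, card_univ, Fintype.card_bool] at hcard
  have h1 : ⌊-Y⌋ ≤ ⌊Y⌋ + 1 := (Int.floor_le_floor (by linarith)).trans (by lia)
  have h2 : ((⌊Y⌋ + 1 - ⌊-Y⌋).toNat : ℝ) = ⌊Y⌋ + 1 - ⌊-Y⌋ := by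
    have : ((⌊Y⌋ + 1 - ⌊-Y⌋).toNat : ℤ) = ⌊Y⌋ + 1 - ⌊-Y⌋ := Int.toNat_of_nonneg (by lia)
    exact_mod_cast this
  have h3 : (#P : ℝ) ≤ 2 * ((⌊Y⌋ + 1 - ⌊-Y⌋).toNat : ℝ) := by exact_mod_cast hcard
  rw [h2] at h3
  have := Int.floor_le Y
  have := Int.lt_floor_add_one (-Y)
  linarith

/-- A lattice of determinant `n` has few primitive points in a box. -/
theorem card_lattice_le (n Δ : ℕ) (hn : 0 < n) (P : Finset (ℤ × ℤ))
    (h : ∀ p ∈ P, p.1 ≠ 0 ∧ p.2 ≠ 0 ∧ |p.1| ≤ Δ ∧ |p.2| ≤ Δ ∧ IsCoprime p.1 p.2)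
    (hd : ∀ p ∈ P, ∀ p' ∈ P, (n : ℤ) ∣ p.1 * p'.2 - p'.1 * p.2) :
    (#P : ℝ) ≤ 8 * ((Δ : ℝ) ^ 2 / n + 1) := by
  have h1 := card_lattice_half_le n Δ hn (P.filter fun p => |p.2| ≤ |p.1|)
    (fun p hp => by
      rw [mem_filter] at hp
      obtain ⟨a, b, c, d, e⟩ := h p hp.1
      exact ⟨a, c, hp.2, e⟩)
    (fun p hp p' hp' => hd p (mem_filter.mp hp).1 p' (mem_filter.mp hp').1)
  have h2 := card_lattice_half_le n Δ hn ((P.filter fun p => ¬ |p.2| ≤ |p.1|).image Prod.swap)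
    (fun p hp => by
      obtain ⟨r, hr, rfl⟩ := mem_image.mp hp
      rw [mem_filter] at hr
      obtain ⟨a, b, c, d, e⟩ := h r hr.1
      exact ⟨b, d, (not_le.mp hr.2).le, e.symm⟩)
    (fun p hp p' hp' => by
      obtain ⟨r, hr, rfl⟩ := mem_image.mp hp
      obtain ⟨r', hr', rfl⟩ := mem_image.mp hp'
      have := hd r' (mem_filter.mp hr').1 r (mem_filter.mp hr).1
      simp only [Prod.fst_swap, Prod.snd_swap]
      convert this using 1; ring)
  rw [card_image_of_injective _ Prod.swap_injective] at h2
  have h3 := card_filter_add_card_filter_not (s := P) (fun p => |p.2| ≤ |p.1|)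
  have h4 : (#P : ℝ) = #{p ∈ P | |p.2| ≤ |p.1|} + #{p ∈ P | ¬ |p.2| ≤ |p.1|} := by
    exact_mod_cast h3.symm
  linarith

/-! ### The congruence `k₁ d₁² ≡ k₂ d₂²` in a box -/

/-- Solutions of `k₁ d₁ ^ 2 ≡ k₂ d₂ ^ 2` modulo `q` with `0 < |kᵢ| ≤ K`, `1 ≤ dᵢ ≤ N` and
`dᵢ` coprime to `q`. -/
noncomputable def quad (q K N : ℕ) : Finset ((ℤ × ℤ) × (ℕ × ℕ)) :=
  ((Icc (-K : ℤ) K ×ˢ Icc (-K : ℤ) K) ×ˢ (Icc 1 N ×ˢ Icc 1 N)).filter fun t =>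
    (t.1.1 ≠ 0 ∧ t.1.2 ≠ 0) ∧ (t.2.1.Coprime q ∧ t.2.2.Coprime q) ∧
      (t.1.1 : ZMod q) * (t.2.1 : ZMod q) ^ 2 = (t.1.2 : ZMod q) * (t.2.2 : ZMod q) ^ 2

/-- The members of `quad` with `k₁, k₂` coprime and `d₁, d₂` coprime. -/
noncomputable def primQuad (q K N : ℕ) : Finset ((ℤ × ℤ) × (ℕ × ℕ)) :=
  (quad q K N).filter fun t => IsCoprime t.1.1 t.1.2 ∧ t.2.1.Coprime t.2.2

theorem mem_quad {q K N : ℕ} {t : (ℤ × ℤ) × (ℕ × ℕ)} :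
    t ∈ quad q K N ↔ ((|t.1.1| ≤ K ∧ |t.1.2| ≤ K) ∧
      ((1 ≤ t.2.1 ∧ t.2.1 ≤ N) ∧ (1 ≤ t.2.2 ∧ t.2.2 ≤ N))) ∧
      (t.1.1 ≠ 0 ∧ t.1.2 ≠ 0) ∧ (t.2.1.Coprime q ∧ t.2.2.Coprime q) ∧
      (t.1.1 : ZMod q) * (t.2.1 : ZMod q) ^ 2 = (t.1.2 : ZMod q) * (t.2.2 : ZMod q) ^ 2 := by
  simp only [quad, mem_filter, mem_product, mem_Icc, abs_le]

/-- For fixed `d₁, d₂`, which are units, any two solutions `(k₁, k₂)` are proportional modulo `n`,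
so `card_lattice_le` applies to each of the at most `N²` pairs. -/
theorem card_primQuad_le_of_d (n K N : ℕ) (hn : 0 < n) :
    (#(primQuad n K N) : ℝ) ≤ (N : ℝ) ^ 2 * (8 * ((K : ℝ) ^ 2 / n + 1)) := by
  classical
  rw [card_eq_sum_card_fiberwise (f := Prod.snd) (t := Icc 1 N ×ˢ Icc 1 N)]
  · push_cast
    refine (sum_le_card_nsmul _ _ (8 * ((K : ℝ) ^ 2 / n + 1)) ?_).trans ?_
    · intro δ _
      have hinj : Set.InjOn (Prod.fst : (ℤ × ℤ) × (ℕ × ℕ) → ℤ × ℤ)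
          ((primQuad n K N).filter fun t => t.2 = δ) := by
        intro a ha b hb hab
        simp only [coe_filter, Set.mem_ofPred_eq] at ha hb
        exact Prod.ext hab (ha.2.trans hb.2.symm)
      rw [← card_image_of_injOn hinj]
      refine card_lattice_le n K hn _ ?_ ?_
      · intro p hp
        obtain ⟨t, ht, rfl⟩ := mem_image.mp hp
        simp only [mem_filter, primQuad, mem_quad] at ht
        tauto
      · intro p hp p' hp'
        obtain ⟨t, ht, rfl⟩ := mem_image.mp hp
        obtain ⟨t', ht', rfl⟩ := mem_image.mp hp'
        simp only [mem_filter, primQuad, mem_quad] at ht ht'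
        obtain ⟨⟨⟨-, -, ⟨c1, c2⟩, e⟩, -⟩, hδ⟩ := ht
        obtain ⟨⟨⟨-, -, -, e'⟩, -⟩, hδ'⟩ := ht'
        rw [← ZMod.intCast_zmod_eq_zero_iff_dvd]
        push_cast
        rw [hδ'] at e'
        rw [hδ] at e c1 c2
        have u : IsUnit ((δ.1 : ZMod n) ^ 2) := ((ZMod.isUnit_iff_coprime _ _).mpr c1).pow 2
        apply u.mul_left_cancel
        linear_combination (t'.1.2 : ZMod n) * e - (t.1.2 : ZMod n) * e'
    · simp [card_product, sq]
  · intro t ht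
    simp only [coe_product, primQuad, coe_filter, Set.mem_ofPred_eq, mem_quad, Set.mem_prod,
      coe_Icc, Set.mem_Icc] at ht ⊢
    tauto

/-- For fixed `k₁, k₂` the ratio `d₂/d₁` is a square root of `k₁/k₂` modulo `n`, so it takes at most
`2 τ(n)` values. Each value confines `(d₁, d₂)` to a lattice of determinant `n`. -/
theorem card_primQuad_le_of_k (n K N : ℕ) [NeZero n] :
    (#(primQuad n K N) : ℝ) ≤
      (2 * K + 1 : ℝ) ^ 2 * ((2 * #n.divisors : ℕ) * (8 * ((N : ℝ) ^ 2 / n + 1))) := by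
  classical
  have hn : 0 < n := Nat.pos_of_ne_zero (NeZero.ne n)
  rw [card_eq_sum_card_fiberwise (f := Prod.fst) (t := Icc (-K : ℤ) K ×ˢ Icc (-K : ℤ) K)]
  · push_cast
    refine (sum_le_card_nsmul _ _ ((2 * #n.divisors : ℕ) * (8 * ((N : ℝ) ^ 2 / n + 1))) ?_).trans ?_
    · intro κ _
      set A := (primQuad n K N).filter fun t => t.1 = κ with hA
      let g : (ℤ × ℤ) × (ℕ × ℕ) → ZMod n := fun t => (t.2.2 : ZMod n) * (t.2.1 : ZMod n)⁻¹
      have hg : ∀ t ∈ A, IsUnit (g t) ∧ g t ^ 2 = (κ.1 : ZMod n) * (κ.2 : ZMod n)⁻¹ ∧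
          (t.2.2 : ZMod n) = g t * t.2.1 := by
        intro t ht
        simp only [hA, mem_filter, primQuad, mem_quad] at ht
        obtain ⟨⟨⟨-, -, ⟨c1, c2⟩, e⟩, hk, -⟩, hκ⟩ := ht
        rw [hκ] at e hk
        have u1 := (ZMod.isUnit_iff_coprime _ _).mpr c1
        have u2 := (ZMod.isUnit_iff_coprime _ _).mpr c2
        have i1 := ZMod.mul_inv_of_unit _ u1
        -- From `a κ₁ + b κ₂ = 1` and `κ₁ = κ₂ (d₂/d₁)²` modulo `n`, the inverse of `κ₂` is `a
        -- (d₂/d₁)² + b`.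
        have hu : IsUnit (κ.2 : ZMod n) := by
          obtain ⟨a, b, hab⟩ := hk
          have hab' := congrArg (Int.cast : ℤ → ZMod n) hab
          push_cast at hab'
          refine isUnit_iff_exists_inv.mpr
            ⟨a * (t.2.2 : ZMod n) ^ 2 * (t.2.1 : ZMod n)⁻¹ ^ 2 + b, ?_⟩
          linear_combination hab' - a * (t.2.1 : ZMod n)⁻¹ ^ 2 * e +
            a * κ.1 * (((t.2.1 : ZMod n) * (t.2.1 : ZMod n)⁻¹) + 1) * i1
        have i2 := ZMod.mul_inv_of_unit _ hu
        refine ⟨?_, ?_, ?_⟩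
        · exact u2.mul (IsUnit.of_mul_eq_one (t.2.1 : ZMod n) (by rw [mul_comm]; exact i1))
        · apply hu.mul_left_cancel
          simp only [g]
          linear_combination -(t.2.1 : ZMod n)⁻¹ ^ 2 * e - κ.1 * i2 +
            κ.1 * (((t.2.1 : ZMod n) * (t.2.1 : ZMod n)⁻¹) + 1) * i1
        · simp only [g]
          linear_combination -(t.2.2 : ZMod n) * i1
      have himg : #(A.image g) ≤ 2 * #n.divisors := by
        refine card_unit_sq_eq_le n _ ((κ.1 : ZMod n) * (κ.2 : ZMod n)⁻¹) ?_
        intro ρ hρ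
        obtain ⟨t, ht, rfl⟩ := mem_image.mp hρ
        exact ⟨(hg t ht).1, (hg t ht).2.1⟩
      rw [card_eq_sum_card_image g A]
      push_cast
      refine (sum_le_card_nsmul _ _ (8 * ((N : ℝ) ^ 2 / n + 1)) ?_).trans ?_
      · intro ρ _
        have hinj : Set.InjOn (fun t : (ℤ × ℤ) × (ℕ × ℕ) => ((t.2.1 : ℤ), (t.2.2 : ℤ)))
            (A.filter fun t => g t = ρ) := by
          intro a ha b hb hab
          simp only [coe_filter, Set.mem_ofPred_eq, hA, mem_filter] at ha hb
          simp only [Prod.mk.injEq, Nat.cast_inj] at hab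
          exact Prod.ext (ha.1.2.trans hb.1.2.symm) (Prod.ext hab.1 hab.2)
        rw [← card_image_of_injOn hinj]
        refine card_lattice_le n N hn _ ?_ ?_
        · intro p hp
          obtain ⟨t, ht, rfl⟩ := mem_image.mp hp
          simp only [mem_filter, hA, primQuad, mem_quad] at ht
          obtain ⟨⟨⟨⟨⟨-, ⟨a1, a2⟩, a3, a4⟩, -⟩, -, hc⟩, -⟩, -⟩ := ht
          simp only [Nat.abs_cast, Nat.cast_le, Nat.isCoprime_iff_coprime]
          refine ⟨by lia, by lia, a2, a4, hc⟩
        · intro p hp p' hp'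
          obtain ⟨t, ht, rfl⟩ := mem_image.mp hp
          obtain ⟨t', ht', rfl⟩ := mem_image.mp hp'
          rw [mem_filter] at ht ht'
          have e := (hg t ht.1).2.2
          have e' := (hg t' ht'.1).2.2
          rw [ht.2] at e
          rw [ht'.2] at e'
          rw [← ZMod.intCast_zmod_eq_zero_iff_dvd]
          push_cast
          linear_combination (t.2.1 : ZMod n) * e' - (t'.2.1 : ZMod n) * e
      · rw [nsmul_eq_mul]
        have : (0 : ℝ) ≤ 8 * ((N : ℝ) ^ 2 / n + 1) := by positivity
        have h2 : (#(A.image g) : ℝ) ≤ 2 * #n.divisors := by exact_mod_cast himg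
        exact mul_le_mul_of_nonneg_right h2 this
    · rw [card_product, Int.card_Icc, nsmul_eq_mul]
      have : ((K : ℤ) + 1 - -K).toNat = 2 * K + 1 := by lia
      rw [this]
      push_cast
      exact le_of_eq (by ring)
  · intro t ht
    simp only [coe_product, primQuad, coe_filter, Set.mem_ofPred_eq, mem_quad, Set.mem_prod,
      coe_Icc, Set.mem_Icc, abs_le] at ht ⊢
    tauto

/-- The shorter pair of variables is fixed, so that its square is at most `KN`. The constant is `144
= 9 · 2 · 8`, with `(2K + 1)² ≤ 9K²` once `K ≥ 1`. -/
theorem card_primQuad_le (n K N : ℕ) [NeZero n] :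
    (#(primQuad n K N) : ℝ) ≤ 144 * #n.divisors * (K * N + (K : ℝ) ^ 2 * N ^ 2 / n) := by
  have hn : 0 < n := Nat.pos_of_ne_zero (NeZero.ne n)
  rcases Nat.eq_zero_or_pos K with rfl | hK
  · have : primQuad n 0 N = ∅ := by
      ext t
      simp only [primQuad, mem_filter, mem_quad, notMem_empty, iff_false]
      rintro ⟨⟨⟨⟨h, -⟩, -⟩, ⟨h0, -⟩, -⟩, -⟩
      simp only [Nat.cast_zero, abs_nonpos_iff] at h
      exact h0 h
    rw [this]
    simp
  have hK1 : (1 : ℝ) ≤ K := by exact_mod_cast hK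
  have hτ : (1 : ℝ) ≤ #n.divisors := by
    exact_mod_cast card_pos.mpr (Nat.nonempty_divisors.mpr hn.ne')
  have hN : (0 : ℝ) ≤ N := by positivity
  rcases le_total (K : ℝ) N with h | h
  · refine (card_primQuad_le_of_k n K N).trans ?_
    have h1 : (2 * K + 1 : ℝ) ^ 2 ≤ 9 * (K : ℝ) ^ 2 := by nlinarith
    have h2 : (K : ℝ) ^ 2 ≤ K * N := by rw [sq]; gcongr
    calc (2 * K + 1 : ℝ) ^ 2 * ((2 * #n.divisors : ℕ) * (8 * ((N : ℝ) ^ 2 / n + 1)))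
        ≤ (9 * (K : ℝ) ^ 2) * ((2 * #n.divisors : ℕ) * (8 * ((N : ℝ) ^ 2 / n + 1))) := by gcongr
      _ = 144 * #n.divisors * ((K : ℝ) ^ 2 + (K : ℝ) ^ 2 * N ^ 2 / n) := by push_cast; ring
      _ ≤ _ := by gcongr
  · refine (card_primQuad_le_of_d n K N hn).trans ?_
    have h2 : (N : ℝ) ^ 2 ≤ K * N := by rw [sq]; gcongr
    calc (N : ℝ) ^ 2 * (8 * ((K : ℝ) ^ 2 / n + 1))
        = 8 * 1 * ((N : ℝ) ^ 2 + (K : ℝ) ^ 2 * N ^ 2 / n) := by ring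
      _ ≤ 144 * #n.divisors * (K * N + (K : ℝ) ^ 2 * N ^ 2 / n) := by gcongr; norm_num

/-- Divide by `e = gcd(k₁, k₂)` and `f = gcd(d₁, d₂)`. The factor `f²` is a unit modulo `q` and
cancels; cancelling `e` lowers the modulus to `q / gcd(e, q)`. -/
theorem card_quad_le_sum (q K N : ℕ) [NeZero q] :
    #(quad q K N) ≤ ∑ p ∈ Icc 1 K ×ˢ Icc 1 N,
      #(primQuad (q / Nat.gcd p.1 q) (K / p.1) (N / p.2)) := by
  classical
  let F : (ℤ × ℤ) × (ℕ × ℕ) → ℕ × ℕ := fun t => (Int.gcd t.1.1 t.1.2, Nat.gcd t.2.1 t.2.2)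
  have hmaps : ∀ t ∈ quad q K N, F t ∈ Icc 1 K ×ˢ Icc 1 N := by
    intro t ht
    rw [mem_quad] at ht
    obtain ⟨⟨⟨a1, a2⟩, ⟨a3, a4⟩, -⟩, ⟨b1, b2⟩, -, -⟩ := ht
    simp only [F, mem_product, mem_Icc]
    have h1 := Int.gcd_pos_of_ne_zero_left t.1.2 b1
    have h2 := Nat.gcd_pos_of_pos_left t.2.2 a3
    have h3 : Int.gcd t.1.1 t.1.2 ≤ t.1.1.natAbs := Nat.gcd_le_left _ (by lia)
    have h4 := Nat.gcd_le_left t.2.2 a3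
    rw [Int.abs_eq_natAbs] at a1
    lia
  rw [card_eq_sum_card_fiberwise hmaps]
  refine sum_le_sum fun p hp => ?_
  let G : (ℤ × ℤ) × (ℕ × ℕ) → (ℤ × ℤ) × (ℕ × ℕ) :=
    fun t => ((t.1.1 / p.1, t.1.2 / p.1), (t.2.1 / p.2, t.2.2 / p.2))
  simp only [mem_product, mem_Icc] at hp
  obtain ⟨⟨he, -⟩, hf, -⟩ := hp
  have hdiv : ∀ t ∈ quad q K N, F t = p → ∃ κ₁ κ₂ : ℤ, ∃ δ₁ δ₂ : ℕ,
      t = ((p.1 * κ₁, p.1 * κ₂), (p.2 * δ₁, p.2 * δ₂)) ∧ G t = ((κ₁, κ₂), (δ₁, δ₂)) ∧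
      IsCoprime κ₁ κ₂ ∧ δ₁.Coprime δ₂ := by
    intro t ht hF
    have hF1 : Int.gcd t.1.1 t.1.2 = p.1 := congrArg Prod.fst hF
    have hF2 : Nat.gcd t.2.1 t.2.2 = p.2 := congrArg Prod.snd hF
    have c1 : ((p.1 : ℕ) : ℤ) ∣ t.1.1 := by rw [← hF1]; exact Int.gcd_dvd_left ..
    have c2 : ((p.1 : ℕ) : ℤ) ∣ t.1.2 := by rw [← hF1]; exact Int.gcd_dvd_right ..
    have c3 : p.2 ∣ t.2.1 := by rw [← hF2]; exact Nat.gcd_dvd_left ..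
    have c4 : p.2 ∣ t.2.2 := by rw [← hF2]; exact Nat.gcd_dvd_right ..
    refine ⟨t.1.1 / p.1, t.1.2 / p.1, t.2.1 / p.2, t.2.2 / p.2, ?_, rfl, ?_, ?_⟩
    · rw [Int.mul_ediv_cancel' c1, Int.mul_ediv_cancel' c2, Nat.mul_div_cancel' c3,
        Nat.mul_div_cancel' c4]
    · rw [Int.isCoprime_iff_gcd_eq_one, ← hF1]
      exact Int.gcd_div_gcd_div_gcd (by lia)
    · rw [← hF2]
      exact Nat.coprime_div_gcd_div_gcd (by lia)
  refine card_le_card_of_injOn G ?_ ?_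
  · intro t ht
    simp only [coe_filter, Set.mem_ofPred_eq] at ht
    obtain ⟨κ₁, κ₂, δ₁, δ₂, rfl, hG, hc1, hc2⟩ := hdiv t ht.1 ht.2
    rw [hG]
    have hq := ht.1
    rw [mem_quad] at hq
    obtain ⟨⟨⟨a1, a2⟩, ⟨a3, a4⟩, ⟨a5, a6⟩⟩, ⟨b1, b2⟩, ⟨d1, d2⟩, e⟩ := hq
    simp only at a1 a2 a3 a4 a5 a6 b1 b2 d1 d2 e
    set n := q / Nat.gcd p.1 q with hn
    have hnq : n ∣ q := Nat.div_dvd_of_dvd (Nat.gcd_dvd_right _ _)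
    simp only [primQuad, mem_coe, mem_filter, mem_quad]
    have hepos : (0 : ℤ) < p.1 := by exact_mod_cast he
    refine ⟨⟨⟨⟨?_, ?_⟩, ⟨?_, ?_⟩, ?_, ?_⟩, ⟨?_, ?_⟩, ⟨?_, ?_⟩, ?_⟩, hc1, hc2⟩
    · rw [abs_mul, Nat.abs_cast] at a1
      push_cast
      rw [Int.le_ediv_iff_mul_le hepos]
      linarith
    · rw [abs_mul, Nat.abs_cast] at a2
      push_cast
      rw [Int.le_ediv_iff_mul_le hepos]
      linarith
    · exact Nat.pos_of_ne_zero fun h => by simp [h] at a3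
    · rw [Nat.le_div_iff_mul_le (by lia)]; linarith
    · exact Nat.pos_of_ne_zero fun h => by simp [h] at a5
    · rw [Nat.le_div_iff_mul_le (by lia)]; linarith
    · exact right_ne_zero_of_mul b1
    · exact right_ne_zero_of_mul b2
    · exact (Nat.Coprime.coprime_mul_left d1).coprime_dvd_right hnq
    · exact (Nat.Coprime.coprime_mul_left d2).coprime_dvd_right hnq
    · have h1 : (q : ℤ) ∣ p.1 * (p.2 ^ 2 * (κ₁ * δ₁ ^ 2 - κ₂ * δ₂ ^ 2)) := by
        rw [← ZMod.intCast_zmod_eq_zero_iff_dvd]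
        push_cast at e ⊢
        linear_combination e
      have h2 : (n : ℤ) ∣ p.2 ^ 2 * (κ₁ * δ₁ ^ 2 - κ₂ * δ₂ ^ 2) := by
        have hg0 : 0 < Nat.gcd p.1 q := Nat.gcd_pos_of_pos_left _ he
        have hcop : IsCoprime (n : ℤ) ((p.1 / Nat.gcd p.1 q : ℕ) : ℤ) := by
          rw [Nat.isCoprime_iff_coprime]
          exact (Nat.coprime_div_gcd_div_gcd hg0).symm
        have e1 : (q : ℤ) = (Nat.gcd p.1 q : ℕ) * n := by
          exact_mod_cast (Nat.mul_div_cancel' (Nat.gcd_dvd_right p.1 q)).symm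
        have e2 : (p.1 : ℤ) = (Nat.gcd p.1 q : ℕ) * (p.1 / Nat.gcd p.1 q : ℕ) := by
          exact_mod_cast (Nat.mul_div_cancel' (Nat.gcd_dvd_left p.1 q)).symm
        have h1' := h1
        rw [e1] at h1'
        nth_rewrite 1 [e2] at h1'
        rw [mul_assoc] at h1'
        exact hcop.dvd_of_dvd_mul_left
          (Int.dvd_of_mul_dvd_mul_left (by exact_mod_cast hg0.ne') h1')
      have hcop : IsCoprime (n : ℤ) ((p.2 : ℤ) ^ 2) := by
        apply IsCoprime.pow_right
        rw [Nat.isCoprime_iff_coprime]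
        exact ((Nat.Coprime.coprime_mul_right d1).coprime_dvd_right hnq).symm
      have h3 := hcop.dvd_of_dvd_mul_left h2
      rw [← ZMod.intCast_zmod_eq_zero_iff_dvd] at h3
      push_cast at h3
      exact sub_eq_zero.mp h3
  · intro t ht t' ht' hG
    simp only [coe_filter, Set.mem_ofPred_eq] at ht ht'
    obtain ⟨κ₁, κ₂, δ₁, δ₂, h1, h2, -⟩ := hdiv t ht.1 ht.2
    obtain ⟨κ₁', κ₂', δ₁', δ₂', h1', h2', -⟩ := hdiv t' ht'.1 ht'.2
    rw [h2, h2'] at hG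
    simp only [Prod.mk.injEq] at hG
    obtain ⟨⟨rfl, rfl⟩, rfl, rfl⟩ := hG
    rw [h1, h1']

theorem sum_Icc_inv_le (n : ℕ) : ∑ e ∈ Icc 1 n, (1 : ℝ) / e ≤ 1 + Real.log n := by
  have := harmonic_le_one_add_log n
  rw [harmonic_eq_sum_Icc] at this
  push_cast at this
  simpa using this

/-- Upper bound of the expected order for the number of solutions of
`k₁ d₁ ^ 2 ≡ k₂ d₂ ^ 2` modulo `q` in a box. -/
theorem card_quad_le (q K N : ℕ) [NeZero q] :
    (#(quad q K N) : ℝ) ≤ 144 * #q.divisors * ((1 + Real.log K) * (1 + Real.log N)) *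
      (K * N + (K : ℝ) ^ 2 * N ^ 2 / q) := by
  have hq : 0 < q := Nat.pos_of_ne_zero (NeZero.ne q)
  have hq' : (0 : ℝ) < q := by exact_mod_cast hq
  set W : ℝ := 144 * #q.divisors * (K * N + (K : ℝ) ^ 2 * N ^ 2 / q) with hW
  have hW0 : 0 ≤ W := by positivity
  -- Since `n = q / gcd(e, q) ≥ q / e`, lowering the modulus loses a factor at most `e`, while the
  -- shrunken box gains `e² f²` in the second term. Both terms thus decay at least like `1/(ef)`,
  -- and the sum over `e, f` is a product of harmonic sums.
  have hterm : ∀ p ∈ Icc 1 K ×ˢ Icc 1 N,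
      (#(primQuad (q / Nat.gcd p.1 q) (K / p.1) (N / p.2)) : ℝ) ≤
        W * ((1 / (p.1 : ℝ)) * (1 / (p.2 : ℝ))) := by
    intro p hp
    simp only [mem_product, mem_Icc] at hp
    obtain ⟨⟨he, -⟩, hf, -⟩ := hp
    have hg0 : 0 < Nat.gcd p.1 q := Nat.gcd_pos_of_pos_left _ he
    have hgq := Nat.gcd_dvd_right p.1 q
    set n := q / Nat.gcd p.1 q with hn
    have hn0 : 0 < n := Nat.div_pos (Nat.le_of_dvd hq hgq) hg0
    have : NeZero n := ⟨hn0.ne'⟩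
    have hqe : (q : ℝ) ≤ n * p.1 := by
      have h1 : n * Nat.gcd p.1 q = q := Nat.div_mul_cancel hgq
      have h2 : n * Nat.gcd p.1 q ≤ n * p.1 :=
        Nat.mul_le_mul_left _ (Nat.gcd_le_left _ (by lia))
      rw [h1] at h2
      exact_mod_cast h2
    have hτ : (#n.divisors : ℝ) ≤ #q.divisors := by
      exact_mod_cast card_le_card (Nat.divisors_subset_of_dvd hq.ne' (Nat.div_dvd_of_dvd hgq))
    have he' : (1 : ℝ) ≤ p.1 := by exact_mod_cast he
    have hf' : (1 : ℝ) ≤ p.2 := by exact_mod_cast hf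
    have hn' : (0 : ℝ) < n := by exact_mod_cast hn0
    have hK : ((K / p.1 : ℕ) : ℝ) ≤ K / p.1 := Nat.cast_div_le
    have hN : ((N / p.2 : ℕ) : ℝ) ≤ N / p.2 := Nat.cast_div_le
    refine (card_primQuad_le n (K / p.1) (N / p.2)).trans ?_
    calc 144 * (#n.divisors : ℝ) * (((K / p.1 : ℕ) : ℝ) * ((N / p.2 : ℕ) : ℝ) +
          ((K / p.1 : ℕ) : ℝ) ^ 2 * ((N / p.2 : ℕ) : ℝ) ^ 2 / n)
        ≤ 144 * #q.divisors * ((K / p.1) * (N / p.2) +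
          ((K : ℝ) / p.1) ^ 2 * ((N : ℝ) / p.2) ^ 2 / n) := by gcongr
      _ ≤ 144 * #q.divisors * ((K / p.1) * (N / p.2) +
          (K : ℝ) ^ 2 * (N : ℝ) ^ 2 / q / (p.1 * p.2)) := by
          refine mul_le_mul_of_nonneg_left (add_le_add_right ?_ _) (by positivity)
          rw [div_pow, div_pow, div_mul_div_comm, div_div, div_div]
          refine div_le_div_of_nonneg_left (by positivity) (by positivity) ?_
          calc (q : ℝ) * (p.1 * p.2) ≤ (n * p.1) * (p.1 * p.2) := by gcongr
            _ = p.1 ^ 2 * (p.2 * 1) * n := by ring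
            _ ≤ p.1 ^ 2 * (p.2 * p.2) * n := by gcongr
            _ = p.1 ^ 2 * p.2 ^ 2 * n := by ring
      _ = W * ((1 / (p.1 : ℝ)) * (1 / (p.2 : ℝ))) := by rw [hW]; field_simp
  calc (#(quad q K N) : ℝ)
      ≤ ∑ p ∈ Icc 1 K ×ˢ Icc 1 N,
        (#(primQuad (q / Nat.gcd p.1 q) (K / p.1) (N / p.2)) : ℝ) := by
        exact_mod_cast card_quad_le_sum q K N
    _ ≤ ∑ p ∈ Icc 1 K ×ˢ Icc 1 N, W * ((1 / (p.1 : ℝ)) * (1 / (p.2 : ℝ))) := sum_le_sum hterm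
    _ = W * ((∑ e ∈ Icc 1 K, 1 / (e : ℝ)) * ∑ f ∈ Icc 1 N, 1 / (f : ℝ)) := by
        rw [sum_mul_sum, ← sum_product', mul_sum]
    _ ≤ W * ((1 + Real.log K) * (1 + Real.log N)) := by
        have h1 := sum_Icc_inv_le K
        have h2 := sum_Icc_inv_le N
        have h3 : 0 ≤ Real.log K := Real.log_natCast_nonneg K
        gcongr
    _ = _ := by rw [hW]; ring

/-! ### Small and large `d`; Fourier analysis of the small part -/

/-- The number of `m ≤ X / d ^ 2` with `d ^ 2 m ≡ a` modulo `q`. -/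
noncomputable def cnt (X q d : ℕ) (a : ZMod q) : ℕ :=
  #((Icc 1 (X / d ^ 2)).filter fun m : ℕ => (d : ZMod q) ^ 2 * (m : ZMod q) = a)

/-- The centred count of multiples of squares of small `d`. -/
noncomputable def smallPart (X q D : ℕ) (a : ZMod q) : ℝ :=
  ∑ d ∈ Icc 1 D with d.Coprime q, (ArithmeticFunction.moebius d : ℝ) *
    (cnt X q d a - ((X / d ^ 2 : ℕ) : ℝ) / q)

/-- The contribution of large `d` to `S`. -/
noncomputable def largePart (X q D : ℕ) (a : ZMod q) : ℝ :=
  ∑ d ∈ Ioc D X with d.Coprime q, (ArithmeticFunction.moebius d : ℝ) * cnt X q d a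

theorem parseval (q : ℕ) [NeZero q] (g : ZMod q → ℝ) :
    ∑ r : ZMod q, ‖∑ a, (g a : ℂ) * ZMod.stdAddChar (a * r)‖ ^ 2 = q * ∑ a, g a ^ 2 := by
  have key : ∀ r : ZMod q, ((‖∑ a, (g a : ℂ) * ZMod.stdAddChar (a * r)‖ ^ 2 : ℝ) : ℂ) =
      ∑ a, ∑ b, (g a : ℂ) * g b * ZMod.stdAddChar (r * (a - b)) := by
    intro r
    rw [← Complex.normSq_eq_norm_sq, Complex.normSq_eq_conj_mul_self, mul_comm, map_sum,
      sum_mul_sum]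
    refine sum_congr rfl fun a _ => sum_congr rfl fun b _ => ?_
    rw [map_mul (starRingEnd ℂ), Complex.conj_ofReal, ← AddChar.map_neg_eq_conj,
      show r * (a - b) = a * r + -(b * r) by ring, AddChar.map_add_eq_mul]
    ring
  have h : ((∑ r : ZMod q, ‖∑ a, (g a : ℂ) * ZMod.stdAddChar (a * r)‖ ^ 2 : ℝ) : ℂ) =
      ((q * ∑ a, g a ^ 2 : ℝ) : ℂ) := by
    push_cast
    have key' := fun r => key r
    push_cast at key'
    simp_rw [key']
    rw [sum_comm]
    rw [mul_sum]
    refine sum_congr rfl fun a _ => ?_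
    rw [sum_comm]
    simp_rw [← mul_sum, AddChar.sum_mulShift _ (ZMod.isPrimitive_stdAddChar q), sub_eq_zero]
    simp [ZMod.card]
    ring
  exact_mod_cast h

/-- A geometric sum of ratio `z` is at most `2 / |z - 1|`, and `|z - 1| = 2 |sin(πk/q)| ≥ 4|k|/q` by
Jordan's inequality, `k` being the least absolute residue. -/
theorem norm_geom_sum_stdAddChar_le (q M : ℕ) [NeZero q] (s : ZMod q) (hs : s ≠ 0) :
    ‖∑ m ∈ Icc 1 M, ZMod.stdAddChar ((m : ZMod q) * s)‖ ≤ q / |(s.valMinAbs : ℝ)| := by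
  set z : ℂ := ZMod.stdAddChar s with hz
  have hq : (0 : ℝ) < q := by exact_mod_cast Nat.pos_of_ne_zero (NeZero.ne q)
  set k : ℤ := s.valMinAbs with hk
  have hk0 : k ≠ 0 := by rwa [hk, Ne, ZMod.valMinAbs_eq_zero]
  have hkpos : 0 < |(k : ℝ)| := abs_pos.mpr (by exact_mod_cast hk0)
  have hk2 : 2 * |(k : ℝ)| ≤ q := by
    have h1 := ZMod.natAbs_valMinAbs_le s
    have h2 : 2 * |k| ≤ (q : ℤ) := by rw [Int.abs_eq_natAbs]; lia
    exact_mod_cast h2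
  have hz1 : ‖z - 1‖ ≥ 4 * |(k : ℝ)| / q := by
    have h1 : z = Complex.exp (Complex.I * ((2 * Real.pi * k / q : ℝ) : ℂ)) := by
      rw [hz, ← ZMod.coe_valMinAbs s, ← hk, ZMod.stdAddChar_coe]
      congr 1
      push_cast
      ring
    rw [h1, Complex.norm_exp_I_mul_ofReal_sub_one, norm_mul, Real.norm_eq_abs, Real.norm_eq_abs,
      show 2 * Real.pi * k / q / 2 = Real.pi * k / q by ring]
    have habs : |Real.pi * k / q| = Real.pi * (|(k : ℝ)| / q) := by
      rw [abs_div, abs_mul, abs_of_pos Real.pi_pos, abs_of_pos hq, mul_div_assoc]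
    have hle : |Real.pi * k / q| ≤ Real.pi / 2 := by
      rw [habs]
      have : |(k : ℝ)| / q ≤ 1 / 2 := by rw [div_le_div_iff₀ hq two_pos]; linarith
      calc Real.pi * (|(k : ℝ)| / q) ≤ Real.pi * (1 / 2) := by gcongr
        _ = _ := by ring
    have := Real.mul_abs_le_abs_sin hle
    rw [habs] at this
    have e : 2 / Real.pi * (Real.pi * (|(k : ℝ)| / q)) = 2 * |(k : ℝ)| / q := by
      field_simp
    rw [e] at this
    rw [abs_two]
    calc 4 * |(k : ℝ)| / q = 2 * (2 * |(k : ℝ)| / q) := by ring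
      _ ≤ _ := by gcongr
  have hzpos : 0 < ‖z - 1‖ := lt_of_lt_of_le (by positivity) hz1
  have hz' : z ≠ 1 := fun h => by simp [h] at hzpos
  have hnz : ‖z‖ = 1 := AddChar.norm_apply _ _
  have hpow : ∀ m : ℕ, ZMod.stdAddChar ((m : ZMod q) * s) = z ^ m := by
    intro m
    rw [hz, ← nsmul_eq_mul, AddChar.map_nsmul_eq_pow]
  have hsum : (∑ m ∈ Icc 1 M, z ^ m) * (z - 1) = z * (z ^ M - 1) := by
    induction M with
    | zero => simp
    | succ M ih =>
      rw [sum_Icc_succ_top (by lia), add_mul, ih]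
      ring
  simp_rw [hpow]
  have hnorm := congrArg norm hsum
  rw [norm_mul, norm_mul, hnz, one_mul] at hnorm
  have h2 : ‖z ^ M - 1‖ ≤ 2 := by
    calc ‖z ^ M - 1‖ ≤ ‖z ^ M‖ + ‖(1 : ℂ)‖ := norm_sub_le _ _
      _ = 2 := by rw [norm_pow, hnz, one_pow, norm_one]; norm_num
  rw [le_div_iff₀ hkpos]
  have h3 : ‖∑ m ∈ Icc 1 M, z ^ m‖ * (4 * |(k : ℝ)| / q) ≤ 2 :=
    (mul_le_mul_of_nonneg_left hz1 (norm_nonneg _)).trans (hnorm.le.trans h2)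
  have h4 : ‖∑ m ∈ Icc 1 M, z ^ m‖ * (4 * |(k : ℝ)| / q) =
      4 * (‖∑ m ∈ Icc 1 M, z ^ m‖ * |(k : ℝ)|) / q := by ring
  rw [h4, div_le_iff₀ hq] at h3
  linarith

/-- The weight attached to the frequency `r` by the modulus `d`. -/
noncomputable def weight (X q d : ℕ) (r : ZMod q) : ℝ :=
  min ((X : ℝ) / (d ^ 2 * q)) (1 / |((r * (d : ZMod q) ^ 2).valMinAbs : ℝ)|)

theorem sum_cnt_mul (X q d : ℕ) [NeZero q] (f : ZMod q → ℂ) :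
    ∑ a, (cnt X q d a : ℂ) * f a = ∑ m ∈ Icc 1 (X / d ^ 2), f ((d : ZMod q) ^ 2 * m) := by
  simp only [cnt, card_filter]
  push_cast
  simp_rw [sum_mul]
  rw [sum_comm]
  refine sum_congr rfl fun m _ => ?_
  simp

theorem fourier_smallPart (X q D : ℕ) [NeZero q] (r : ZMod q) :
    ∑ a, ((smallPart X q D a : ℝ) : ℂ) * ZMod.stdAddChar (a * r) =
      ∑ d ∈ Icc 1 D with d.Coprime q, (ArithmeticFunction.moebius d : ℂ) *
        (∑ m ∈ Icc 1 (X / d ^ 2), ZMod.stdAddChar ((d : ZMod q) ^ 2 * (m : ZMod q) * r) -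
          ((X / d ^ 2 : ℕ) : ℂ) / q * ∑ a : ZMod q, ZMod.stdAddChar (a * r)) := by
  simp only [smallPart]
  push_cast
  simp_rw [sum_mul]
  rw [sum_comm]
  refine sum_congr rfl fun d _ => ?_
  rw [← sum_cnt_mul X q d (fun a => ZMod.stdAddChar (a * r)), mul_sum _ _ (_ / _ : ℂ),
    ← sum_sub_distrib, mul_sum]
  exact sum_congr rfl fun a _ => by ring

theorem norm_fourier_smallPart_le (X q D : ℕ) [NeZero q] (r : ZMod q) (hr : r ≠ 0) :
    ‖∑ a, ((smallPart X q D a : ℝ) : ℂ) * ZMod.stdAddChar (a * r)‖ ≤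
      q * ∑ d ∈ Icc 1 D with d.Coprime q, weight X q d r := by
  have hq : (0 : ℝ) < q := by exact_mod_cast Nat.pos_of_ne_zero (NeZero.ne q)
  rw [fourier_smallPart, mul_sum]
  refine (norm_sum_le _ _).trans (sum_le_sum fun d hd => ?_)
  rw [mem_filter, mem_Icc] at hd
  have hd0 : (0 : ℝ) < d := by exact_mod_cast hd.1.1
  have hu : IsUnit ((d : ZMod q) ^ 2) := ((ZMod.isUnit_iff_coprime _ _).mpr hd.2).pow 2
  have hs : r * (d : ZMod q) ^ 2 ≠ 0 := fun h => hr (by simpa using hu.mul_left_eq_zero.mp h)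
  rw [AddChar.sum_mulShift _ (ZMod.isPrimitive_stdAddChar q), if_neg hr, Nat.cast_zero, mul_zero,
    sub_zero, norm_mul]
  have hμ : ‖(ArithmeticFunction.moebius d : ℂ)‖ ≤ 1 := by
    rw [Complex.norm_intCast]
    exact_mod_cast ArithmeticFunction.abs_moebius_le_one
  refine (mul_le_of_le_one_left (norm_nonneg _) hμ).trans ?_
  rw [weight, mul_min_of_nonneg _ _ hq.le, le_min_iff]
  constructor
  · refine (norm_sum_le _ _).trans ?_
    simp only [AddChar.norm_apply, sum_const, Nat.card_Icc, nsmul_eq_mul, mul_one,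
      Nat.add_sub_cancel]
    refine Nat.cast_div_le.trans (le_of_eq ?_)
    push_cast
    field_simp
  · have := norm_geom_sum_stdAddChar_le q (X / d ^ 2) (r * (d : ZMod q) ^ 2) hs
    rw [mul_one_div]
    refine le_trans (le_of_eq ?_) this
    congr 1
    exact sum_congr rfl fun m _ => by congr 1; ring

/-- Parseval; the centring in `smallPart` cancels the frequency `0` exactly and affects no other. -/
theorem sum_sq_smallPart_le (X q D : ℕ) [NeZero q] :
    ∑ a, smallPart X q D a ^ 2 ≤
      q * ∑ r ∈ univ.erase (0 : ZMod q), (∑ d ∈ Icc 1 D with d.Coprime q, weight X q d r) ^ 2 := by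
  have hq : (0 : ℝ) < q := by exact_mod_cast Nat.pos_of_ne_zero (NeZero.ne q)
  have h := parseval q (smallPart X q D)
  have h0 : ∑ a, ((smallPart X q D a : ℝ) : ℂ) * ZMod.stdAddChar (a * 0) = 0 := by
    rw [fourier_smallPart]
    refine sum_eq_zero fun d _ => ?_
    simp only [mul_zero, AddChar.map_zero_eq_one, sum_const, Nat.card_Icc, Nat.add_sub_cancel,
      nsmul_eq_mul, mul_one, card_univ, ZMod.card]
    have : (q : ℂ) ≠ 0 := by exact_mod_cast NeZero.ne q
    rw [div_mul_cancel₀ _ this, sub_self, mul_zero]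
  rw [← add_sum_erase _ _ (mem_univ (0 : ZMod q)), h0, norm_zero, zero_pow two_ne_zero,
    zero_add] at h
  refine le_of_mul_le_mul_left ?_ hq
  rw [← h, mul_sum, mul_sum]
  refine sum_le_sum fun r hr => ?_
  calc _ ≤ (q * ∑ d ∈ Icc 1 D with d.Coprime q, weight X q d r) ^ 2 := by
        gcongr
        exact norm_fourier_smallPart_le X q D r (ne_of_mem_erase hr)
    _ = _ := by ring

/-! ### The main term and the decomposition of `E` -/

/-- The error terms of rounding and of truncating the series for `c q`. -/
theorem abs_main_sub_le (x : ℝ) (hx : 0 ≤ x) (q D : ℕ) (hq : 0 < q) (hD : 0 < D) :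
    |∑ d ∈ Icc 1 D with d.Coprime q,
      (ArithmeticFunction.moebius d : ℝ) * (((⌊x⌋₊ / d ^ 2 : ℕ) : ℝ) / q) - c q * (x / q)| ≤
      D / q + x / (q * D) := by
  have hq' : (0 : ℝ) < q := by exact_mod_cast hq
  have hD' : (0 : ℝ) < D := by exact_mod_cast hD
  set f : ℕ → ℝ := fun d => if d.Coprime q then (ArithmeticFunction.moebius d : ℝ) / (d : ℝ) ^ 2
    else 0 with hf
  have hbound : ∀ d, |f d| ≤ ((d : ℝ) ^ 2)⁻¹ := by
    intro d
    simp only [hf]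
    split_ifs
    · rw [abs_div, abs_pow, Nat.abs_cast, ← one_div]
      gcongr
      exact_mod_cast ArithmeticFunction.abs_moebius_le_one
    · rw [abs_zero]; positivity
  have htail : |∑ d ∈ Icc 1 D, f d - c q| ≤ 1 / D := by
    have hf0 : f 0 = 0 := by simp [hf]
    have hlim := (hasSum_c q).tendsto_sum_nat
    have hlim' := ((hlim.const_sub (∑ d ∈ Icc 1 D, f d)).abs)
    refine le_of_tendsto hlim' ?_
    filter_upwards [Filter.eventually_gt_atTop (D + 1)] with n hn
    have hsplit : ∑ d ∈ range n, f d = ∑ d ∈ Icc 1 D, f d + ∑ d ∈ Ioc D (n - 1), f d := by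
      rw [range_eq_Ico, sum_eq_sum_Ico_succ_bot (by lia), hf0, zero_add,
        ← sum_Ico_consecutive f (show 0 + 1 ≤ D + 1 by lia) (show D + 1 ≤ n by lia)]
      congr 1
      refine sum_congr ?_ fun _ _ => rfl
      ext d
      simp only [mem_Ico, mem_Ioc]
      lia
    change |∑ d ∈ Icc 1 D, f d - ∑ d ∈ range n, f d| ≤ 1 / D
    rw [hsplit, sub_add_cancel_left, abs_neg]
    refine (abs_sum_le_sum_abs _ _).trans ((sum_le_sum fun d _ => hbound d).trans ?_)
    refine (sum_Ioc_inv_sq_le_sub hD.ne' (by lia)).trans ?_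
    rw [one_div]
    have : (0 : ℝ) ≤ ((n - 1 : ℕ) : ℝ)⁻¹ := by positivity
    linarith
  have hround : |∑ d ∈ Icc 1 D with d.Coprime q,
      ((ArithmeticFunction.moebius d : ℝ) * (((⌊x⌋₊ / d ^ 2 : ℕ) : ℝ) / q) - f d * (x / q))| ≤
      D / q := by
    refine (abs_sum_le_sum_abs _ _).trans ?_
    refine (sum_le_card_nsmul _ _ (1 / (q : ℝ)) fun d hd => ?_).trans ?_
    · rw [mem_filter, mem_Icc] at hd
      have hd0 : (0 : ℝ) < (d : ℝ) ^ 2 := by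
        have : (0 : ℝ) < d := by exact_mod_cast hd.1.1
        positivity
      -- Integer division of `⌊x⌋` by `d²` is the floor of `x / d²`, so each `d` contributes a
      -- rounding error of at most `1/q`.
      have e1 : ⌊x⌋₊ / d ^ 2 = ⌊x / (d : ℝ) ^ 2⌋₊ := by
        have := Nat.floor_div_natCast x (d ^ 2)
        push_cast at this
        exact this.symm
      have h1 := Nat.floor_le (show 0 ≤ x / (d : ℝ) ^ 2 by positivity)
      have h2 := Nat.lt_floor_add_one (x / (d : ℝ) ^ 2)
      have e2 : (ArithmeticFunction.moebius d : ℝ) * (((⌊x⌋₊ / d ^ 2 : ℕ) : ℝ) / q) -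
          f d * (x / q) = (ArithmeticFunction.moebius d : ℝ) *
            (⌊x / (d : ℝ) ^ 2⌋₊ - x / (d : ℝ) ^ 2) / q := by
        rw [e1]
        simp only [hf, if_pos hd.2]
        ring
      rw [e2, abs_div, abs_mul, abs_of_pos hq']
      gcongr
      have hμ : |(ArithmeticFunction.moebius d : ℝ)| ≤ 1 := by
        exact_mod_cast ArithmeticFunction.abs_moebius_le_one
      refine mul_le_one₀ hμ (abs_nonneg _) (abs_le.mpr ⟨by linarith, by linarith⟩)
    · rw [nsmul_eq_mul, mul_one_div]
      gcongr
      exact_mod_cast (card_filter_le _ _).trans (by simp)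
  have hfsum : ∑ d ∈ Icc 1 D with d.Coprime q, f d * (x / q) = (∑ d ∈ Icc 1 D, f d) * (x / q) := by
    rw [sum_mul, sum_filter]
    refine sum_congr rfl fun d _ => ?_
    simp only [hf]
    split_ifs <;> simp
  rw [sum_sub_distrib, hfsum] at hround
  have h3 : |(∑ d ∈ Icc 1 D, f d - c q) * (x / q)| ≤ x / (q * D) := by
    rw [abs_mul, abs_of_nonneg (show 0 ≤ x / q by positivity)]
    calc _ ≤ 1 / (D : ℝ) * (x / q) := by gcongr
      _ = _ := by field_simp
  have := abs_add_le (∑ d ∈ Icc 1 D with d.Coprime q,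
      (ArithmeticFunction.moebius d : ℝ) * (((⌊x⌋₊ / d ^ 2 : ℕ) : ℝ) / q) -
      (∑ d ∈ Icc 1 D, f d) * (x / q)) ((∑ d ∈ Icc 1 D, f d - c q) * (x / q))
  rw [show ∀ A B C : ℝ, A - B * (x / q) + (B - C) * (x / q) = A - C * (x / q) by
    intros; ring] at this
  linarith

/-- Only `d` coprime to `q` survive, because `d² m ≡ a` with `a` a unit makes `d` a unit. -/
theorem S_eq_sum (x : ℝ) (q : ℕ) (a : ZMod q) (ha : IsUnit a) :
    S x q a = ∑ d ∈ Icc 1 ⌊x⌋₊ with d.Coprime q,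
      (ArithmeticFunction.moebius d : ℝ) * cnt ⌊x⌋₊ q d a := by
  set X := ⌊x⌋₊
  have h1 : S x q a = ∑ n ∈ (Icc 1 X).filter (fun n : ℕ => (n : ZMod q) = a),
      ∑ d ∈ Icc 1 X, if d ^ 2 ∣ n then (ArithmeticFunction.moebius d : ℝ) else 0 := by
    refine sum_congr rfl fun n hn => ?_
    rw [mem_filter, mem_Icc] at hn
    rw [abs_moebius_eq_sum n (by lia) (Icc 1 X), sum_filter]
    intro d hd
    have h0 : d ≠ 0 := by rintro rfl; simp at hd; lia
    have h2 := Nat.le_of_dvd (by lia) hd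
    have h3 : d ≤ d ^ 2 := Nat.le_self_pow two_ne_zero d
    rw [mem_Icc]
    lia
  rw [h1, sum_comm, sum_filter]
  refine sum_congr rfl fun d hd => ?_
  rw [mem_Icc] at hd
  rw [← sum_filter, sum_const, nsmul_eq_mul, mul_comm]
  have hd2 : 0 < d ^ 2 := Nat.pow_pos hd.1
  have hcnt : #{n ∈ (Icc 1 X).filter (fun n : ℕ => (n : ZMod q) = a) | d ^ 2 ∣ n} =
      cnt X q d a := by
    symm
    refine card_bij (fun m _ => d ^ 2 * m) ?_ ?_ ?_
    · intro m hm
      simp only [mem_filter, mem_Icc] at hm ⊢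
      obtain ⟨⟨b1, b2⟩, b3⟩ := hm
      rw [Nat.le_div_iff_mul_le hd2] at b2
      refine ⟨⟨⟨Nat.mul_pos hd2 b1, by linarith⟩, by push_cast; exact b3⟩, Dvd.intro m rfl⟩
    · intro m _ m' _ h
      exact Nat.eq_of_mul_eq_mul_left hd2 h
    · intro n hn
      simp only [mem_filter, mem_Icc] at hn
      obtain ⟨⟨⟨b1, b2⟩, b3⟩, m, rfl⟩ := hn
      refine ⟨m, ?_, rfl⟩
      simp only [mem_filter, mem_Icc, Nat.le_div_iff_mul_le hd2]
      push_cast at b3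
      exact ⟨⟨Nat.pos_of_ne_zero fun h => by simp [h] at b1, by linarith⟩, b3⟩
  rw [hcnt]
  split_ifs with hco
  · rfl
  · have : cnt X q d a = 0 := by
      rw [cnt, card_eq_zero, filter_eq_empty_iff]
      intro m _ h
      apply hco
      rw [← ZMod.isUnit_iff_coprime]
      rw [← h] at ha
      exact (isUnit_pow_iff two_ne_zero).mp (isUnit_of_mul_isUnit_left ha)
    rw [this]
    simp

theorem E_eq (x : ℝ) (q D : ℕ) (a : ZMod q) (ha : IsUnit a) (hD : D ≤ ⌊x⌋₊) :
    E x q a = smallPart ⌊x⌋₊ q D a + largePart ⌊x⌋₊ q D a +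
      (∑ d ∈ Icc 1 D with d.Coprime q,
      (ArithmeticFunction.moebius d : ℝ) * (((⌊x⌋₊ / d ^ 2 : ℕ) : ℝ) / q) - c q * (x / q)) := by
  have hsplit : (Icc 1 ⌊x⌋₊).filter (fun d => d.Coprime q) =
      (Icc 1 D).filter (fun d => d.Coprime q) ∪ (Ioc D ⌊x⌋₊).filter (fun d => d.Coprime q) := by
    rw [← filter_union]
    congr 1
    ext d
    simp only [mem_union, mem_Icc, mem_Ioc]
    lia
  have hdisj : Disjoint ((Icc 1 D).filter (fun d => d.Coprime q))
      ((Ioc D ⌊x⌋₊).filter (fun d => d.Coprime q)) := by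
    refine disjoint_filter_filter (disjoint_left.mpr fun d h1 h2 => ?_)
    rw [mem_Icc] at h1
    rw [mem_Ioc] at h2
    lia
  rw [E, S_eq_sum x q a ha, hsplit, sum_union hdisj, smallPart, largePart]
  simp_rw [mul_sub]
  rw [sum_sub_distrib]
  ring

/-! ### Second moments reduced to the congruence count -/

theorem sum_card_fiber_sq {α β : Type*} [DecidableEq α] [Fintype β] [DecidableEq β]
    (T : Finset α) (g : α → β) :
    ∑ b, #{t ∈ T | g t = b} ^ 2 = #{p ∈ T ×ˢ T | g p.1 = g p.2} := by
  rw [card_eq_sum_card_fiberwise (f := fun p => g p.1) (t := univ)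
    (fun _ _ => mem_coe.mpr (mem_univ _))]
  refine sum_congr rfl fun b _ => ?_
  rw [sq, ← card_product]
  congr 1
  ext p
  simp only [mem_product, mem_filter]
  constructor
  · rintro ⟨⟨h1, h2⟩, h3, h4⟩
    exact ⟨⟨⟨h1, h3⟩, h2.trans h4.symm⟩, h2⟩
  · rintro ⟨⟨⟨h1, h2⟩, h3⟩, h4⟩
    exact ⟨⟨h1, h4⟩, h2, h3.symm.trans h4⟩

theorem sum_card_sq_mul_eq_le (q K N : ℕ) [NeZero q] (T : Finset (ℕ × ℤ))
    (hT : ∀ t ∈ T, (1 ≤ t.1 ∧ t.1 ≤ N) ∧ t.1.Coprime q ∧ t.2 ≠ 0 ∧ |t.2| ≤ K) :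
    ∑ a : ZMod q, #{t ∈ T | (t.2 : ZMod q) * (t.1 : ZMod q) ^ 2 = a} ^ 2 ≤ #(quad q K N) := by
  rw [sum_card_fiber_sq]
  refine card_le_card_of_injOn (fun p => ((p.1.2, p.2.2), (p.1.1, p.2.1))) ?_ ?_
  · intro p hp
    simp only [coe_filter, mem_product, Set.mem_ofPred_eq] at hp
    obtain ⟨⟨h1, h2⟩, h⟩ := hp
    have := hT _ h1
    have := hT _ h2
    simp only [mem_coe, mem_quad]
    tauto
  · rintro ⟨⟨a, b⟩, c, d⟩ _ ⟨⟨a', b'⟩, c', d'⟩ _ h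
    simp only [Prod.mk.injEq] at h ⊢
    tauto

/-- Two members with the same `r` satisfy `k₁/d₁² = k₂/d₂²`, that is `k₁ d₂² = k₂ d₁²`: hence the
exchange of the `d`'s in the injection into `quad`. -/
theorem sum_card_eq_mul_sq_le (q K N : ℕ) [NeZero q] (T : Finset (ℕ × ℤ))
    (hT : ∀ t ∈ T, (1 ≤ t.1 ∧ t.1 ≤ N) ∧ t.1.Coprime q ∧ t.2 ≠ 0 ∧ |t.2| ≤ K) :
    ∑ r : ZMod q, #{t ∈ T | (t.2 : ZMod q) = r * (t.1 : ZMod q) ^ 2} ^ 2 ≤ #(quad q K N) := by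
  have hinv : ∀ t ∈ T, (t.1 : ZMod q) * (t.1 : ZMod q)⁻¹ = 1 := fun t ht =>
    ZMod.mul_inv_of_unit _ ((ZMod.isUnit_iff_coprime _ _).mpr (hT t ht).2.1)
  have hfib : ∀ r : ZMod q, T.filter (fun t => (t.2 : ZMod q) = r * (t.1 : ZMod q) ^ 2) =
      T.filter (fun t => (t.2 : ZMod q) * (t.1 : ZMod q)⁻¹ ^ 2 = r) := by
    intro r
    refine filter_congr fun t ht => ?_
    have h := hinv t ht
    constructor
    · intro e
      rw [e, mul_assoc, ← mul_pow, h, one_pow, mul_one]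
    · intro e
      rw [← e, mul_assoc, ← mul_pow, mul_comm _ (t.1 : ZMod q), h, one_pow, mul_one]
  simp_rw [hfib]
  rw [sum_card_fiber_sq]
  refine card_le_card_of_injOn (fun p => ((p.1.2, p.2.2), (p.2.1, p.1.1))) ?_ ?_
  · intro p hp
    simp only [coe_filter, mem_product, Set.mem_ofPred_eq] at hp
    obtain ⟨⟨h1, h2⟩, h⟩ := hp
    have b1 := hT _ h1
    have b2 := hT _ h2
    have i1 := hinv _ h1
    have i2 := hinv _ h2
    have e : (p.1.2 : ZMod q) * (p.2.1 : ZMod q) ^ 2 = (p.2.2 : ZMod q) * (p.1.1 : ZMod q) ^ 2 := by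
      have i1' : (p.1.1 : ZMod q) ^ 2 * (p.1.1 : ZMod q)⁻¹ ^ 2 = 1 := by rw [← mul_pow, i1, one_pow]
      have i2' : (p.2.1 : ZMod q) ^ 2 * (p.2.1 : ZMod q)⁻¹ ^ 2 = 1 := by rw [← mul_pow, i2, one_pow]
      linear_combination (p.1.1 : ZMod q) ^ 2 * (p.2.1 : ZMod q) ^ 2 * h -
        (p.1.2 : ZMod q) * (p.2.1 : ZMod q) ^ 2 * i1' +
        (p.2.2 : ZMod q) * (p.1.1 : ZMod q) ^ 2 * i2'
    simp only [mem_coe, mem_quad]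
    tauto
  · rintro ⟨⟨a, b⟩, c, d⟩ _ ⟨⟨a', b'⟩, c', d'⟩ _ h
    simp only [Prod.mk.injEq] at h ⊢
    tauto

/-- Cauchy–Schwarz over the dyadic blocks `2^j ≤ d < 2^(j+1)` that meet `d > D`; within a block `m ≤
X / 4^j`. -/
theorem sum_sq_largePart_le (X q D : ℕ) [NeZero q] :
    ∑ a, largePart X q D a ^ 2 ≤ (Nat.log 2 X + 1 : ℕ) *
      ∑ j ∈ range (Nat.log 2 X + 1) with D < 2 ^ (j + 1),
        (#(quad q (X / 4 ^ j) (2 ^ (j + 1))) : ℝ) := by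
  classical
  set J := (range (Nat.log 2 X + 1)).filter fun j => D < 2 ^ (j + 1) with hJ
  have hJcard : (#J : ℝ) ≤ (Nat.log 2 X + 1 : ℕ) := by
    exact_mod_cast (card_filter_le _ _).trans (card_range _).le
  let A : ℕ → Finset ℕ := fun j =>
    ((Ioc D X).filter fun d => d.Coprime q).filter fun d => Nat.log 2 d = j
  let T : ℕ → Finset (ℕ × ℤ) := fun j => A j ×ˢ Icc (1 : ℤ) ((X / 4 ^ j : ℕ) : ℤ)
  have hA : ∀ j, ∀ d ∈ A j, (D < d ∧ d ≤ X) ∧ d.Coprime q ∧ 2 ^ j ≤ d ∧ d < 2 ^ (j + 1) := by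
    intro j d hd
    simp only [A, mem_filter, mem_Ioc] at hd
    obtain ⟨⟨h1, h2⟩, rfl⟩ := hd
    exact ⟨h1, h2, Nat.pow_log_le_self 2 (by lia), Nat.lt_pow_succ_log_self one_lt_two d⟩
  obtain ⟨n, hn⟩ : ∃ n : ℕ → ZMod q → ℕ, ∀ j a,
      n j a = #{t ∈ T j | (t.2 : ZMod q) * (t.1 : ZMod q) ^ 2 = a} := ⟨_, fun _ _ => rfl⟩
  have hcnt : ∀ j a, ∑ d ∈ A j, cnt X q d a ≤ n j a := by
    intro j a
    rw [hn]
    rw [card_filter, sum_product]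
    refine sum_le_sum fun d hd => ?_
    rw [← card_filter, cnt]
    refine card_le_card_of_injOn (fun m : ℕ => (m : ℤ)) ?_ (fun _ _ _ _ h => by simpa using h)
    intro m hm
    simp only [coe_filter, Set.mem_ofPred_eq, mem_Icc] at hm ⊢
    obtain ⟨⟨m1, m2⟩, m3⟩ := hm
    have h4 : 4 ^ j ≤ d ^ 2 := by
      rw [show 4 = 2 ^ 2 by norm_num, ← pow_mul, mul_comm, pow_mul]
      exact Nat.pow_le_pow_left (hA j d hd).2.2.1 2
    have h5 : X / d ^ 2 ≤ X / 4 ^ j := Nat.div_le_div_left h4 (by positivity)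
    refine ⟨⟨by lia, by exact_mod_cast m2.trans h5⟩, ?_⟩
    push_cast
    rw [mul_comm]
    exact m3
  have hpt : ∀ a, largePart X q D a ^ 2 ≤ (Nat.log 2 X + 1 : ℕ) *
      ∑ j ∈ J, (n j a : ℝ) ^ 2 := by
    intro a
    have h1 : |largePart X q D a| ≤
        ∑ j ∈ J, (n j a : ℝ) := by
      calc |largePart X q D a|
          ≤ ∑ d ∈ Ioc D X with d.Coprime q, (cnt X q d a : ℝ) := by
            refine (abs_sum_le_sum_abs _ _).trans (sum_le_sum fun d _ => ?_)
            rw [abs_mul, Nat.abs_cast]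
            refine mul_le_of_le_one_left (by positivity) ?_
            exact_mod_cast ArithmeticFunction.abs_moebius_le_one
        _ = ∑ j ∈ J, ∑ d ∈ A j, (cnt X q d a : ℝ) := by
            refine (sum_fiberwise_of_maps_to (fun d hd => ?_) _).symm
            simp only [mem_filter, mem_Ioc] at hd
            simp only [hJ, mem_filter, mem_range]
            have := Nat.log_mono_right (b := 2) hd.1.2
            have := Nat.lt_pow_succ_log_self one_lt_two d
            exact ⟨by lia, by lia⟩
        _ ≤ _ := sum_le_sum fun j _ => by exact_mod_cast hcnt j a
    have h0 : (0 : ℝ) ≤ ∑ j ∈ J,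
        (n j a : ℝ) ^ 2 := by positivity
    calc largePart X q D a ^ 2 = |largePart X q D a| ^ 2 := (sq_abs _).symm
      _ ≤ (∑ j ∈ J, (n j a : ℝ)) ^ 2 := by gcongr
      _ ≤ #J * ∑ j ∈ J, (n j a : ℝ) ^ 2 :=
          sq_sum_le_card_mul_sum_sq
      _ ≤ _ := mul_le_mul_of_nonneg_right hJcard h0
  calc ∑ a, largePart X q D a ^ 2
      ≤ ∑ a, (Nat.log 2 X + 1 : ℕ) *
      ∑ j ∈ J, (n j a : ℝ) ^ 2 :=
        sum_le_sum fun a _ => hpt a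
    _ = (Nat.log 2 X + 1 : ℕ) * ∑ j ∈ J,
        ((∑ a, n j a ^ 2 : ℕ) : ℝ) := by
        rw [← mul_sum, sum_comm]
        push_cast
        rfl
    _ ≤ _ := by
        refine mul_le_mul_of_nonneg_left (sum_le_sum fun j _ => Nat.cast_le.mpr ?_)
          (Nat.cast_nonneg _)
        simp_rw [hn]
        refine sum_card_sq_mul_eq_le q _ _ (T j) fun t ht => ?_
        simp only [T, mem_product, mem_Icc] at ht
        obtain ⟨h1, h2, h3⟩ := ht
        obtain ⟨⟨b1, b2⟩, b3, b4, b5⟩ := hA j _ h1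
        exact ⟨⟨by lia, b5.le⟩, b3, by lia, by rw [abs_of_pos (by lia)]; exact h3⟩

/-- Blocks are dyadic both in `d` and in the least absolute residue `k` of `r d²`, which is nonzero
because `r ≠ 0` and `d` is a unit. The weight is at most its value at the lower corner of a block,
and Cauchy–Schwarz is applied over the blocks. -/
theorem sum_sq_weight_le (X q D : ℕ) [NeZero q] :
    ∑ r ∈ univ.erase (0 : ZMod q), (∑ d ∈ Icc 1 D with d.Coprime q, weight X q d r) ^ 2 ≤
      ((Nat.log 2 D + 1) * (Nat.log 2 q + 1) : ℕ) *
      ∑ p ∈ range (Nat.log 2 D + 1) ×ˢ range (Nat.log 2 q + 1),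
        min ((X : ℝ) / (4 ^ p.1 * q)) (1 / 2 ^ p.2) ^ 2 *
          (#(quad q (2 ^ (p.2 + 1)) (2 ^ (p.1 + 1))) : ℝ) := by
  classical
  have hq : (0 : ℝ) < q := by exact_mod_cast Nat.pos_of_ne_zero (NeZero.ne q)
  set I := range (Nat.log 2 D + 1) ×ˢ range (Nat.log 2 q + 1) with hI
  let B : Finset ℕ := (Icc 1 D).filter fun d => d.Coprime q
  let κ : ZMod q → ℕ → ℤ := fun r d => (r * (d : ZMod q) ^ 2).valMinAbs
  let w : ℕ × ℕ → ℝ := fun p => min ((X : ℝ) / (4 ^ p.1 * q)) (1 / 2 ^ p.2)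
  have hw0 : ∀ p, 0 ≤ w p := fun p => by positivity
  let T : ℕ × ℕ → Finset (ℕ × ℤ) := fun p =>
    (B.filter fun d => Nat.log 2 d = p.1) ×ˢ
      ((Icc (-(2 ^ (p.2 + 1) : ℕ) : ℤ) ((2 ^ (p.2 + 1) : ℕ) : ℤ)).filter fun k => k ≠ 0)
  obtain ⟨n, hn⟩ : ∃ n : ℕ × ℕ → ZMod q → ℕ, ∀ p r,
      n p r = #{t ∈ T p | (t.2 : ZMod q) = r * (t.1 : ZMod q) ^ 2} := ⟨_, fun _ _ => rfl⟩
  have hcount : ∀ r : ZMod q, r ≠ 0 → ∑ d ∈ B, weight X q d r ≤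
      ∑ p ∈ I, w p * (n p r : ℝ) := by
    intro r hr
    have hB : ∀ d ∈ B, (1 ≤ d ∧ d ≤ D) ∧ κ r d ≠ 0 := by
      intro d hd
      simp only [B, mem_filter, mem_Icc] at hd
      have hu : IsUnit ((d : ZMod q) ^ 2) := ((ZMod.isUnit_iff_coprime _ _).mpr hd.2).pow 2
      refine ⟨hd.1, ?_⟩
      rw [Ne, ZMod.valMinAbs_eq_zero]
      exact fun h => hr (by simpa using hu.mul_left_eq_zero.mp h)
    let cl : ℕ → ℕ × ℕ := fun d => (Nat.log 2 d, Nat.log 2 (κ r d).natAbs)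
    rw [← sum_fiberwise_of_maps_to (g := cl) (t := I)]
    · refine sum_le_sum fun p _ => ?_
      refine (sum_le_card_nsmul _ _ (w p) fun d hd => ?_).trans ?_
      · rw [mem_filter] at hd
        obtain ⟨hd, rfl⟩ := hd
        obtain ⟨⟨h1, -⟩, h2⟩ := hB d hd
        have e1 : (4 : ℝ) ^ Nat.log 2 d ≤ (d : ℝ) ^ 2 := by
          rw [show (4 : ℝ) = 2 ^ 2 by norm_num, ← pow_mul, mul_comm, pow_mul]
          gcongr
          exact_mod_cast Nat.pow_log_le_self 2 (by lia : d ≠ 0)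
        have e2 : (2 : ℝ) ^ Nat.log 2 (κ r d).natAbs ≤ |((κ r d : ℤ) : ℝ)| := by
          rw [← Int.cast_abs, Int.abs_eq_natAbs]
          exact_mod_cast Nat.pow_log_le_self 2 (Int.natAbs_ne_zero.mpr h2)
        simp only [weight, w, cl]
        exact min_le_min (by gcongr) (by gcongr)
      · rw [nsmul_eq_mul, mul_comm]
        refine mul_le_mul_of_nonneg_left ?_ (hw0 p)
        rw [hn]
        refine Nat.cast_le.mpr ?_
        refine card_le_card_of_injOn (fun d => (d, κ r d)) ?_ (fun _ _ _ _ h => by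
          simpa using congrArg Prod.fst h)
        intro d hd
        simp only [coe_filter, Set.mem_ofPred_eq] at hd
        obtain ⟨hd, hcl⟩ := hd
        obtain ⟨-, h2⟩ := hB d hd
        have hp1 : Nat.log 2 d = p.1 := (congrArg Prod.fst hcl : (cl d).1 = p.1)
        have hp2 : Nat.log 2 (κ r d).natAbs = p.2 := (congrArg Prod.snd hcl : (cl d).2 = p.2)
        have hlt := Nat.lt_pow_succ_log_self one_lt_two (κ r d).natAbs
        rw [hp2] at hlt
        simp only [T, coe_filter, mem_product, mem_filter, mem_Icc, Set.mem_ofPred_eq]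
        exact ⟨⟨⟨hd, hp1⟩, ⟨by lia, by lia⟩, h2⟩, ZMod.coe_valMinAbs _⟩
    · intro d hd
      obtain ⟨⟨-, h1⟩, -⟩ := hB d hd
      have h3 := Nat.log_mono_right (b := 2) h1
      have h4 : (κ r d).natAbs ≤ q :=
        (ZMod.natAbs_valMinAbs_le _).trans (Nat.div_le_self _ _)
      have h5 := Nat.log_mono_right (b := 2) h4
      simp only [hI, cl, mem_product, mem_range]
      lia
  have hIcard : (#I : ℝ) = ((Nat.log 2 D + 1) * (Nat.log 2 q + 1) : ℕ) := by
    rw [hI, card_product, card_range, card_range]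
  have hpt : ∀ r ∈ univ.erase (0 : ZMod q), (∑ d ∈ B, weight X q d r) ^ 2 ≤
      #I * ∑ p ∈ I, w p ^ 2 *
        (n p r : ℝ) ^ 2 := by
    intro r hr
    have h0 : 0 ≤ ∑ d ∈ B, weight X q d r := sum_nonneg fun d _ => by rw [weight]; positivity
    calc _ ≤ (∑ p ∈ I, w p * (n p r : ℝ)) ^ 2 :=
          pow_le_pow_left₀ h0 (hcount r (ne_of_mem_erase hr)) 2
      _ ≤ _ := sq_sum_le_card_mul_sum_sq
      _ = _ := by simp_rw [mul_pow]
  refine (sum_le_sum hpt).trans ?_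
  rw [← mul_sum, sum_comm, hIcard]
  gcongr with p hp
  rw [← mul_sum]
  gcongr
  have hT := sum_card_eq_mul_sq_le q (2 ^ (p.2 + 1)) (2 ^ (p.1 + 1)) (T p) fun t ht => by
    simp only [T, B, mem_product, mem_filter, mem_Icc] at ht
    obtain ⟨⟨⟨⟨h1, -⟩, h2⟩, h3⟩, h4, h5⟩ := ht
    have := Nat.lt_pow_succ_log_self one_lt_two t.1
    rw [h3] at this
    exact ⟨⟨h1, this.le⟩, h2, h5, abs_le.mpr h4⟩
  calc _ ≤ ∑ r : ZMod q,
        (n p r : ℝ) ^ 2 :=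
        sum_le_sum_of_subset_of_nonneg (erase_subset _ _) fun _ _ _ => by positivity
    _ ≤ _ := by
        simp_rw [← hn] at hT
        exact_mod_cast hT

/-! ### The variance bound -/

theorem log_two_add_one_le (x : ℝ) (n : ℕ) (hn : 1 ≤ n) (hnx : (n : ℝ) ≤ x) :
    ((Nat.log 2 n + 1 : ℕ) : ℝ) ≤ 2 + 2 * Real.log x := by
  have h1 : (Nat.log 2 n : ℝ) ≤ Real.logb 2 n := Real.natLog_le_logb n 2
  have hn' : (1 : ℝ) ≤ n := by exact_mod_cast hn
  have h2 : Real.log n ≤ Real.log x := Real.log_le_log (by linarith) hnx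
  have h0 : 0 ≤ Real.log n := Real.log_nonneg hn'
  have hl := Real.log_two_gt_d9
  have h3 : Real.logb 2 n ≤ 2 * Real.log n := by
    rw [Real.logb, div_le_iff₀ (by linarith)]
    nlinarith
  push_cast
  linarith

theorem one_add_log_le (x : ℝ) (hx : 1 ≤ x) (n : ℕ) (hn : (n : ℝ) ≤ 2 * x) :
    1 + Real.log n ≤ 2 + 2 * Real.log x := by
  have hl := Real.log_two_lt_d9
  have h0 := Real.log_nonneg hx
  rcases Nat.eq_zero_or_pos n with rfl | h
  · simp; linarith
  have h' : (0 : ℝ) < n := by exact_mod_cast h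
  have := Real.log_le_log h' hn
  rw [Real.log_mul (by norm_num) (by linarith)] at this
  linarith

theorem card_quad_le_of_le (x : ℝ) (hx : 1 ≤ x) (q K N : ℕ) [NeZero q] (hK : (K : ℝ) ≤ 2 * x)
    (hN : (N : ℝ) ≤ 2 * x) :
    (#(quad q K N) : ℝ) ≤ 144 * #q.divisors * (2 + 2 * Real.log x) ^ 2 *
      (K * N + (K : ℝ) ^ 2 * N ^ 2 / q) := by
  refine (card_quad_le q K N).trans ?_
  have h1 := one_add_log_le x hx K hK
  have h2 := one_add_log_le x hx N hN
  have h3 : 0 ≤ Real.log N := Real.log_natCast_nonneg N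
  have h0 := Real.log_nonneg hx
  rw [sq (2 + 2 * Real.log x)]
  gcongr

/-- On a block with `|k| ~ u`, `d ~ v` and weight `w`, the term `KN` contributes `(q w v)(w u)`,
where `w u ≤ 1` and `(q w v)² q = w (w v² q) q² ≤ x²`; here `q² ≤ x` enters. The term `K²N²/q`
contributes `(w u)² v² ≤ D² ≤ V`. With `K = 2u`, `N = 2v` the constant is `2880 = 144 (4 + 16)`. -/
theorem sum_sq_smallPart_le_of_le (x V : ℝ) (hx : 1 ≤ x) (q X D : ℕ) [NeZero q]
    (hX : (X : ℝ) ≤ x) (hq : (q : ℝ) ^ 2 ≤ x) (hD : 0 < D) (hDx : (D : ℝ) ≤ x)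
    (hV : 0 ≤ V) (hV2 : V ^ 2 = x ^ 2 / q) (hDV : (D : ℝ) ^ 2 ≤ V) :
    ∑ a, smallPart X q D a ^ 2 ≤ 2880 * (2 + 2 * Real.log x) ^ 6 * #q.divisors * V := by
  have hqn : 0 < q := Nat.pos_of_ne_zero (NeZero.ne q)
  have hq1 : (1 : ℝ) ≤ q := by exact_mod_cast hqn
  have hq0 : (0 : ℝ) < q := by linarith
  have hqx : (q : ℝ) ≤ x := by nlinarith
  set Λ : ℝ := 2 + 2 * Real.log x with hΛ
  have hlog := Real.log_nonneg hx
  have hΛ0 : 0 ≤ Λ := by linarith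
  set M : ℝ := 2880 * #q.divisors * Λ ^ 2 * V with hM
  have hM0 : 0 ≤ M := by positivity
  have hterm : ∀ p ∈ range (Nat.log 2 D + 1) ×ˢ range (Nat.log 2 q + 1),
      q * (min ((X : ℝ) / (4 ^ p.1 * q)) (1 / 2 ^ p.2) ^ 2 *
          (#(quad q (2 ^ (p.2 + 1)) (2 ^ (p.1 + 1))) : ℝ)) ≤ M := by
    intro p hp
    simp only [mem_product, mem_range] at hp
    set v : ℝ := 2 ^ p.1 with hv
    set u : ℝ := 2 ^ p.2 with hu
    have hv1 : 1 ≤ v := one_le_pow₀ one_le_two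
    have hu1 : 1 ≤ u := one_le_pow₀ one_le_two
    have hvD : v ≤ D := by
      have : 2 ^ p.1 ≤ D := (Nat.pow_le_pow_right two_pos (by lia)).trans
        (Nat.pow_log_le_self 2 hD.ne')
      rw [hv]
      exact_mod_cast this
    have huq : u ≤ q := by
      have : 2 ^ p.2 ≤ q := (Nat.pow_le_pow_right two_pos (by lia)).trans
        (Nat.pow_log_le_self 2 hqn.ne')
      rw [hu]
      exact_mod_cast this
    have hK : ((2 ^ (p.2 + 1) : ℕ) : ℝ) = 2 * u := by push_cast; rw [hu, pow_succ]; ring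
    have hN : ((2 ^ (p.1 + 1) : ℕ) : ℝ) = 2 * v := by push_cast; rw [hv, pow_succ]; ring
    have h4 : (4 : ℝ) ^ p.1 = v ^ 2 := by
      rw [hv, show (4 : ℝ) = 2 ^ 2 by norm_num, ← pow_mul, ← pow_mul, mul_comm]
    rw [h4]
    set w : ℝ := min ((X : ℝ) / (v ^ 2 * q)) (1 / u) with hw
    have hw0 : 0 ≤ w := by positivity
    have hwu : w * u ≤ 1 := by
      calc w * u ≤ 1 / u * u := by gcongr; exact min_le_right _ _
        _ = 1 := by field_simp
    have hw1 : w ≤ 1 := by nlinarith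
    have hwv : w * v ^ 2 * q ≤ x := by
      calc w * v ^ 2 * q ≤ (X : ℝ) / (v ^ 2 * q) * v ^ 2 * q := by
            gcongr
            exact min_le_left _ _
        _ = (X : ℝ) := by field_simp
        _ ≤ x := hX
    have hqwv : q * w * v ≤ V := by
      refine (abs_le_of_sq_le_sq' ?_ hV).2
      rw [hV2, le_div_iff₀ hq0]
      calc (q * w * v) ^ 2 * q = w * (w * v ^ 2 * q) * q ^ 2 := by ring
        _ ≤ 1 * x * x := by gcongr
        _ = x ^ 2 := by ring
    have hcard := card_quad_le_of_le x hx q (2 ^ (p.2 + 1)) (2 ^ (p.1 + 1))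
      (by rw [hK]; linarith) (by rw [hN]; linarith)
    rw [hK, hN] at hcard
    calc q * (w ^ 2 * (#(quad q (2 ^ (p.2 + 1)) (2 ^ (p.1 + 1))) : ℝ))
        ≤ q * (w ^ 2 * (144 * #q.divisors * Λ ^ 2 *
          (2 * u * (2 * v) + (2 * u) ^ 2 * (2 * v) ^ 2 / q))) := by gcongr
      _ = 144 * #q.divisors * Λ ^ 2 * (4 * ((q * w * v) * (w * u)) + 16 * ((w * u) ^ 2 * v ^ 2)) := by
          field_simp
          ring
      _ ≤ 144 * #q.divisors * Λ ^ 2 * (4 * (V * 1) + 16 * (1 ^ 2 * (D : ℝ) ^ 2)) := by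
          gcongr
      _ ≤ 144 * #q.divisors * Λ ^ 2 * (4 * (V * 1) + 16 * (1 ^ 2 * V)) := by gcongr
      _ = M := by rw [hM]; ring
  have hI : (((Nat.log 2 D + 1) * (Nat.log 2 q + 1) : ℕ) : ℝ) ≤ Λ ^ 2 := by
    rw [Nat.cast_mul, sq]
    have h1 := log_two_add_one_le x D hD hDx
    have h2 := log_two_add_one_le x q hqn hqx
    gcongr
  refine (sum_sq_smallPart_le X q D).trans ?_
  refine (mul_le_mul_of_nonneg_left (sum_sq_weight_le X q D) hq0.le).trans ?_
  rw [mul_left_comm, mul_sum]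
  calc _ ≤ (((Nat.log 2 D + 1) * (Nat.log 2 q + 1) : ℕ) : ℝ) *
        ((#(range (Nat.log 2 D + 1) ×ˢ range (Nat.log 2 q + 1)) : ℝ) * M) := by
        gcongr
        rw [← nsmul_eq_mul]
        exact sum_le_card_nsmul _ _ _ hterm
    _ = (((Nat.log 2 D + 1) * (Nat.log 2 q + 1) : ℕ) : ℝ) *
        ((((Nat.log 2 D + 1) * (Nat.log 2 q + 1) : ℕ) : ℝ) * M) := by
        rw [card_product, card_range, card_range]
    _ ≤ Λ ^ 2 * (Λ ^ 2 * M) := by gcongr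
    _ = _ := by rw [hM]; ring

/-- On the block `d ~ v` one has `K ≤ x/v²` and `N = 2v`, so `KN + K²N²/q` is at most `2x/v +
4V²/v²`. As `2v ≥ y`, with `y² = V` and `x ≤ yV`, this is at most `4V + 16V`. -/
theorem sum_sq_largePart_le_of_le (x V y : ℝ) (hx : 1 ≤ x) (q X D : ℕ) [NeZero q]
    (hX : (X : ℝ) ≤ x) (hX1 : 1 ≤ X) (hy : 0 < y) (hyV : y ^ 2 = V) (hxy : x ≤ y * V)
    (hV2 : V ^ 2 = x ^ 2 / q) (hDy : y < D + 1) :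
    ∑ a, largePart X q D a ^ 2 ≤ 2880 * (2 + 2 * Real.log x) ^ 4 * #q.divisors * V := by
  have hqn : 0 < q := Nat.pos_of_ne_zero (NeZero.ne q)
  have hq0 : (0 : ℝ) < q := by exact_mod_cast hqn
  set Λ : ℝ := 2 + 2 * Real.log x with hΛ
  have hlog := Real.log_nonneg hx
  have hΛ0 : 0 ≤ Λ := by linarith
  have hV : 0 < V := by rw [← hyV]; positivity
  set M : ℝ := 2880 * #q.divisors * Λ ^ 2 * V with hM
  have hM0 : 0 ≤ M := by positivity
  have hterm : ∀ j ∈ (range (Nat.log 2 X + 1)).filter (fun j => D < 2 ^ (j + 1)),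
      (#(quad q (X / 4 ^ j) (2 ^ (j + 1))) : ℝ) ≤ M := by
    intro j hj
    simp only [mem_filter, mem_range] at hj
    obtain ⟨hj1, hj2⟩ := hj
    set v : ℝ := 2 ^ j with hv
    have hv1 : 1 ≤ v := one_le_pow₀ one_le_two
    have hvX : v ≤ X := by
      have : 2 ^ j ≤ X := (Nat.pow_le_pow_right two_pos (by lia)).trans
        (Nat.pow_log_le_self 2 (by lia))
      rw [hv]
      exact_mod_cast this
    have hN : ((2 ^ (j + 1) : ℕ) : ℝ) = 2 * v := by push_cast; rw [hv, pow_succ]; ring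
    have hyv : y ≤ 2 * v := by
      have : ((D + 1 : ℕ) : ℝ) ≤ ((2 ^ (j + 1) : ℕ) : ℝ) := by exact_mod_cast hj2
      rw [hN] at this
      push_cast at this
      linarith
    have hK : ((X / 4 ^ j : ℕ) : ℝ) ≤ x / v ^ 2 := by
      refine Nat.cast_div_le.trans ?_
      push_cast
      rw [show (4 : ℝ) ^ j = v ^ 2 by
        rw [hv, show (4 : ℝ) = 2 ^ 2 by norm_num, ← pow_mul, ← pow_mul, mul_comm]]
      gcongr
    have hKx : ((X / 4 ^ j : ℕ) : ℝ) ≤ 2 * x := by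
      have : ((X / 4 ^ j : ℕ) : ℝ) ≤ X := by exact_mod_cast Nat.div_le_self _ _
      linarith
    have hcard := card_quad_le_of_le x hx q (X / 4 ^ j) (2 ^ (j + 1)) hKx
      (by rw [hN]; linarith)
    rw [hN] at hcard
    have hxv : x / v ≤ 2 * V := by
      rw [div_le_iff₀ (by linarith)]
      nlinarith
    calc _ ≤ _ := hcard
      _ ≤ 144 * #q.divisors * Λ ^ 2 *
          (x / v ^ 2 * (2 * v) + (x / v ^ 2) ^ 2 * (2 * v) ^ 2 / q) := by gcongr
      _ = 144 * #q.divisors * Λ ^ 2 * (2 * (x / v) + 4 * (V ^ 2 / v ^ 2)) := by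
          rw [hV2]
          field_simp
          ring
      _ ≤ 144 * #q.divisors * Λ ^ 2 * (2 * (2 * V) + 4 * (4 * V)) := by
          gcongr
          rw [div_le_iff₀ (by positivity)]
          calc V ^ 2 = V * y ^ 2 := by rw [hyV]; ring
            _ ≤ V * (2 * v) ^ 2 := by gcongr
            _ = 4 * V * v ^ 2 := by ring
      _ = M := by rw [hM]; ring
  have hJ := log_two_add_one_le x X hX1 hX
  refine (sum_sq_largePart_le X q D).trans ?_
  calc _ ≤ ((Nat.log 2 X + 1 : ℕ) : ℝ) *
        ((#((range (Nat.log 2 X + 1)).filter fun j => D < 2 ^ (j + 1)) : ℝ) * M) := by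
        gcongr
        rw [← nsmul_eq_mul]
        exact sum_le_card_nsmul _ _ _ hterm
    _ ≤ ((Nat.log 2 X + 1 : ℕ) : ℝ) * (((Nat.log 2 X + 1 : ℕ) : ℝ) * M) := by
        gcongr
        exact (card_filter_le _ _).trans (card_range _).le
    _ ≤ Λ * (Λ * M) := by gcongr
    _ = _ := by rw [hM]; ring

/-- The variance of `E x q` over reduced residue classes for `q ≤ √x`. -/
theorem variance_le (x : ℝ) (q : ℕ) [NeZero q] (hx : 1 ≤ x) (hqx : (q : ℝ) ^ 2 ≤ x) :
    ∑ a : (ZMod q)ˣ, E x q (a : ZMod q) ^ 2 ≤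
      20000 * (2 + 2 * Real.log x) ^ 6 * #q.divisors * (x / √q) := by
  have hqn : 0 < q := Nat.pos_of_ne_zero (NeZero.ne q)
  have hq1 : (1 : ℝ) ≤ q := by exact_mod_cast hqn
  have hq0 : (0 : ℝ) < q := by linarith
  have hx0 : 0 < x := by linarith
  have hr1 : 1 ≤ √(q : ℝ) := Real.one_le_sqrt.mpr hq1
  have hr2 : √(q : ℝ) ^ 2 = q := Real.sq_sqrt hq0.le
  set r := √(q : ℝ)
  have hrq : r ≤ q := by nlinarith
  set V : ℝ := x / r with hV
  have hV1 : 1 ≤ V := by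
    rw [hV, le_div_iff₀ (by linarith)]
    nlinarith
  have hVx : V ≤ x := div_le_self hx0.le hr1
  have hV2 : V ^ 2 = x ^ 2 / q := by rw [hV, div_pow, hr2]
  -- The cut at `√V` balances the off-diagonal terms `D²` of the small part and `V²/D²` of the large
  -- part.
  set y : ℝ := √V with hy
  have hy1 : 1 ≤ y := Real.one_le_sqrt.mpr hV1
  have hyV : y ^ 2 = V := Real.sq_sqrt (by linarith)
  have hyx : y ≤ x := by nlinarith
  set D : ℕ := ⌊y⌋₊ with hD
  have hD1 : 1 ≤ D := Nat.le_floor (by exact_mod_cast hy1)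
  have hD1' : (1 : ℝ) ≤ D := by exact_mod_cast hD1
  have hDy : (D : ℝ) ≤ y := Nat.floor_le (by linarith)
  have hDy' : y < D + 1 := Nat.lt_floor_add_one y
  have hDX : D ≤ ⌊x⌋₊ := Nat.floor_le_floor hyx
  have hXx : ((⌊x⌋₊ : ℕ) : ℝ) ≤ x := Nat.floor_le hx0.le
  -- Equivalent to `q^(3/2) ≤ x`, which is weaker than `q² ≤ x`.
  have hxy : x ≤ y * V := by
    have h1 : x ^ 2 ≤ (y * V) ^ 2 := by
      rw [mul_pow, hyV, hV2, hV]
      rw [div_mul_div_comm, le_div_iff₀ (by positivity)]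
      have h2 : r * q ≤ x := by nlinarith
      nlinarith [sq_nonneg x]
    exact (abs_le_of_sq_le_sq' h1 (by positivity)).2
  set Λ : ℝ := 2 + 2 * Real.log x with hΛ
  have hΛ1 : 1 ≤ Λ := by have := Real.log_nonneg hx; linarith
  have hsmall := sum_sq_smallPart_le_of_le x V hx q ⌊x⌋₊ D hXx hqx hD1 (hDy.trans hyx)
    (by linarith) hV2 (by rw [← hyV]; gcongr)
  have hlarge := sum_sq_largePart_le_of_le x V y hx q ⌊x⌋₊ D hXx (hD1.trans hDX) (by linarith)
    hyV hxy hV2 hDy'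
  obtain ⟨R, hR⟩ : ∃ R : ℝ, R = ∑ d ∈ Icc 1 D with d.Coprime q,
      (ArithmeticFunction.moebius d : ℝ) * (((⌊x⌋₊ / d ^ 2 : ℕ) : ℝ) / q) - c q * (x / q) :=
    ⟨_, rfl⟩
  -- The factor `2` replaces `D` by `y`: `y < D + 1 ≤ 2D`.
  have hRle : |R| ≤ y / q + 2 * x / (q * y) := by
    rw [hR]
    refine (abs_main_sub_le x hx0.le q D hqn hD1).trans ?_
    have h1 : x / (q * D) ≤ 2 * x / (q * y) := by
      rw [div_le_div_iff₀ (by positivity) (by positivity)]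
      nlinarith [mul_pos hx0 hq0]
    have h2 : (D : ℝ) / q ≤ y / q := by gcongr
    linarith
  have hR2 : q * R ^ 2 ≤ 10 * V := by
    have h1 : R ^ 2 ≤ (y / q + 2 * x / (q * y)) ^ 2 := by
      rw [← sq_abs R]
      gcongr
    have h2 := add_sq_le (a := y / q) (b := 2 * x / (q * y))
    have h3 : q * (2 * ((y / q) ^ 2 + (2 * x / (q * y)) ^ 2)) = 2 * V / q + 8 * V := by
      have e1 : (y / q) ^ 2 = V / q ^ 2 := by rw [div_pow, hyV]
      have e2 : (2 * x / (q * y)) ^ 2 = 4 * V / q := by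
        rw [div_pow, mul_pow, mul_pow, hyV]
        have : x ^ 2 = V ^ 2 * q := by rw [hV2]; field_simp
        rw [this]
        field_simp
        ring
      rw [e1, e2]
      field_simp
      ring
    have h4 : 2 * V / q ≤ 2 * V := div_le_self (by linarith) hq1
    have h5 : q * R ^ 2 ≤ q * (2 * ((y / q) ^ 2 + (2 * x / (q * y)) ^ 2)) := by
      gcongr
      exact h1.trans h2
    linarith
  have hτ : (1 : ℝ) ≤ #q.divisors := by
    exact_mod_cast card_pos.mpr (Nat.nonempty_divisors.mpr hqn.ne')
  have hunits : ∀ f : ZMod q → ℝ, (∀ a, 0 ≤ f a) → ∑ a : (ZMod q)ˣ, f a ≤ ∑ a, f a := by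
    intro f hf
    rw [← sum_image (s := univ) (g := fun u : (ZMod q)ˣ => (u : ZMod q))
      (fun _ _ _ _ h => Units.ext h)]
    exact sum_le_sum_of_subset_of_nonneg (subset_univ _) fun a _ _ => hf a
  have hpt : ∀ a : (ZMod q)ˣ, E x q (a : ZMod q) ^ 2 ≤
      3 * (smallPart ⌊x⌋₊ q D a ^ 2 + largePart ⌊x⌋₊ q D a ^ 2 + R ^ 2) := by
    intro a
    rw [E_eq x q D a a.isUnit hDX, ← hR]
    set A := smallPart ⌊x⌋₊ q D a
    set B := largePart ⌊x⌋₊ q D a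
    nlinarith [sq_nonneg (A - B), sq_nonneg (A - R), sq_nonneg (B - R)]
  have hcardu : (#(univ : Finset (ZMod q)ˣ) : ℝ) ≤ q := by
    rw [card_univ, ZMod.card_units_eq_totient]
    exact_mod_cast Nat.totient_le q
  have hbig : V ≤ Λ ^ 6 * #q.divisors * V := by
    have h1 : (1 : ℝ) ≤ Λ ^ 6 := one_le_pow₀ hΛ1
    have h2 : (1 : ℝ) ≤ Λ ^ 6 * #q.divisors := one_le_mul_of_one_le_of_one_le h1 hτ
    exact le_mul_of_one_le_left (by linarith) h2
  have h46 : Λ ^ 4 * #q.divisors * V ≤ Λ ^ 6 * #q.divisors * V := by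
    have : Λ ^ 4 ≤ Λ ^ 6 := pow_le_pow_right₀ hΛ1 (by norm_num)
    gcongr
  calc ∑ a : (ZMod q)ˣ, E x q (a : ZMod q) ^ 2
      ≤ ∑ a : (ZMod q)ˣ,
        3 * (smallPart ⌊x⌋₊ q D a ^ 2 + largePart ⌊x⌋₊ q D a ^ 2 + R ^ 2) :=
        sum_le_sum fun a _ => hpt a
    _ = 3 * (∑ a : (ZMod q)ˣ, smallPart ⌊x⌋₊ q D a ^ 2 +
        ∑ a : (ZMod q)ˣ, largePart ⌊x⌋₊ q D a ^ 2 + #(univ : Finset (ZMod q)ˣ) * R ^ 2) := by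
        rw [← mul_sum, sum_add_distrib, sum_add_distrib, sum_const, nsmul_eq_mul]
    -- The total constant is `3 (2880 + 2880 + 10) = 17310`.
    _ ≤ 3 * (2880 * Λ ^ 6 * #q.divisors * V + 2880 * Λ ^ 4 * #q.divisors * V + 10 * V) := by
        have h1 := (hunits _ fun a => sq_nonneg (smallPart ⌊x⌋₊ q D a)).trans hsmall
        have h2 := (hunits _ fun a => sq_nonneg (largePart ⌊x⌋₊ q D a)).trans hlarge
        have h3 : #(univ : Finset (ZMod q)ˣ) * R ^ 2 ≤ 10 * V :=
          (mul_le_mul_of_nonneg_right hcardu (sq_nonneg R)).trans hR2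
        linarith
    _ ≤ _ := by linarith

/-! ### Absorbing logarithms and divisors; Chebyshev's inequality -/

/-- Powers of logarithms and of the divisor function are absorbed by `x ^ ε`. -/
theorem log_pow_mul_card_divisors_sq_le (ε : ℝ) (hε : 0 < ε) :
    ∃ C : ℝ, 0 < C ∧ ∀ (x : ℝ) (q : ℕ), 1 ≤ x → q ≠ 0 → (q : ℝ) ≤ x →
      (2 + 2 * Real.log x) ^ 6 * (#q.divisors : ℝ) ^ 2 ≤ C * x ^ ε := by
  -- Eight factors, six logarithmic and two divisor functions, each cost `x^η`.
  set η := ε / 8 with hη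
  have hη0 : 0 < η := by positivity
  obtain ⟨C, hC, hτ⟩ := card_divisors_le_rpow η hη0
  refine ⟨(2 + 2 / η) ^ 6 * C ^ 2, by positivity, fun x q hx hq hqx => ?_⟩
  have hx0 : 0 < x := by linarith
  have h1 : 2 + 2 * Real.log x ≤ (2 + 2 / η) * x ^ η := by
    have h2 := Real.log_le_rpow_div hx0.le hη0
    have h3 : 1 ≤ x ^ η := Real.one_le_rpow hx hη0.le
    calc 2 + 2 * Real.log x ≤ 2 * x ^ η + 2 * (x ^ η / η) := by linarith
      _ = _ := by ring
  have h2 : (#q.divisors : ℝ) ≤ C * x ^ η := (hτ q hq).trans (by gcongr)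
  have h0 : 0 ≤ 2 + 2 * Real.log x := by have := Real.log_nonneg hx; linarith
  calc (2 + 2 * Real.log x) ^ 6 * (#q.divisors : ℝ) ^ 2
      ≤ ((2 + 2 / η) * x ^ η) ^ 6 * (C * x ^ η) ^ 2 := by gcongr
    _ = (2 + 2 / η) ^ 6 * C ^ 2 * (x ^ η) ^ 8 := by ring
    _ = _ := by
        rw [← Real.rpow_natCast (x ^ η) 8, ← Real.rpow_mul hx0.le]
        congr 2
        rw [hη]
        push_cast
        ring

end SquarefreeAP

open SquarefreeAP Finset in
theorem corollary3 (ε : ℝ) (hε : 0 < ε) :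
    ∃ C : ℝ, 0 < C ∧ ∀ (x : ℝ) (q : ℕ), 1 ≤ x → 1 ≤ q → (q : ℝ) ≤ x ^ (1 / 2 : ℝ) →
      1 / (Nat.totient q : ℝ) *
          (Set.ncard {a : (ZMod q)ˣ |
            |SquarefreeAP.E x q (a : ZMod q)| > x ^ (1 / 2 + ε) / (q : ℝ) ^ (3 / 4 : ℝ)} : ℝ)
        ≤ C * x ^ (-ε) := by
  classical
  obtain ⟨C, hC, hbound⟩ := log_pow_mul_card_divisors_sq_le ε hε
  refine ⟨20000 * C, by positivity, fun x q hx hq hqx => ?_⟩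
  have : NeZero q := ⟨by lia⟩
  have hx0 : 0 < x := by linarith
  have hq0 : (0 : ℝ) < q := by exact_mod_cast hq
  have hqx2 : (q : ℝ) ^ 2 ≤ x := by
    calc (q : ℝ) ^ 2 ≤ (x ^ (1 / 2 : ℝ)) ^ 2 := by gcongr
      _ = x := by rw [← Real.sqrt_eq_rpow, Real.sq_sqrt hx0.le]
  have hqx1 : (q : ℝ) ≤ x := by
    have : (1 : ℝ) ≤ q := by exact_mod_cast hq
    nlinarith
  set T : ℝ := x ^ (1 / 2 + ε) / (q : ℝ) ^ (3 / 4 : ℝ) with hT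
  have hT0 : 0 < T := by positivity
  have hφ : (0 : ℝ) < q.totient := by exact_mod_cast Nat.totient_pos.mpr hq
  set A : Finset (ZMod q)ˣ := univ.filter fun a => |E x q (a : ZMod q)| > T with hA
  have hncard : Set.ncard {a : (ZMod q)ˣ | |E x q (a : ZMod q)| > T} = #A := by
    rw [← Set.ncard_coe_finset]
    congr 1
    ext a
    simp [hA]
  rw [hncard]
  have hmarkov : (#A : ℝ) * T ^ 2 ≤
      20000 * (2 + 2 * Real.log x) ^ 6 * #q.divisors * (x / √q) := by
    refine le_trans ?_ (variance_le x q hx hqx2)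
    rw [← nsmul_eq_mul]
    refine (card_nsmul_le_sum A (fun a => E x q (a : ZMod q) ^ 2) (T ^ 2) fun a ha => ?_).trans
      (sum_le_sum_of_subset_of_nonneg (subset_univ _) fun _ _ _ => sq_nonneg _)
    rw [hA, mem_filter] at ha
    rw [← sq_abs (E x q (a : ZMod q))]
    have := ha.2.le
    gcongr
  -- Since `T² = x^(1+2ε) / q^(3/2)`, dividing the variance by `T²` leaves `q x^(-2ε)`; one `x^ε` is
  -- then spent on logarithms and on `τ(q)²`, whose second factor comes from `q ≤ φ(q) τ(q)`.
  have hTV : x / √q = q * x ^ (-(2 * ε)) * T ^ 2 := by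
    have e1 : (x ^ (1 / 2 + ε)) ^ 2 = x * x ^ (2 * ε) := by
      rw [← Real.rpow_natCast, ← Real.rpow_mul hx0.le, ← Real.rpow_one_add' hx0.le (by positivity)]
      congr 1
      push_cast
      ring
    have e2 : ((q : ℝ) ^ (3 / 4 : ℝ)) ^ 2 = q * √q := by
      rw [← Real.rpow_natCast, ← Real.rpow_mul hq0.le, Real.sqrt_eq_rpow,
        ← Real.rpow_one_add' hq0.le (by positivity)]
      congr 1
      norm_num
    rw [hT, div_pow, e1, e2, Real.rpow_neg hx0.le]
    have : x ^ (2 * ε) ≠ 0 := by positivity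
    field_simp
  have hqφ : (q : ℝ) ≤ q.totient * #q.divisors := by
    exact_mod_cast le_totient_mul_card_divisors q
  have hA1 : (#A : ℝ) ≤ 20000 * (2 + 2 * Real.log x) ^ 6 * #q.divisors * (q * x ^ (-(2 * ε))) := by
    refine le_of_mul_le_mul_right ?_ (show 0 < T ^ 2 by positivity)
    refine hmarkov.trans (le_of_eq ?_)
    rw [hTV]
    ring
  have h0 : 0 ≤ 2 + 2 * Real.log x := by have := Real.log_nonneg hx; linarith
  rw [one_div, inv_mul_le_iff₀ hφ]
  calc (#A : ℝ) ≤ 20000 * (2 + 2 * Real.log x) ^ 6 * #q.divisors * (q * x ^ (-(2 * ε))) := hA1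
    _ ≤ 20000 * (2 + 2 * Real.log x) ^ 6 * #q.divisors *
        ((q.totient * #q.divisors) * x ^ (-(2 * ε))) := by gcongr
    _ = 20000 * q.totient * x ^ (-(2 * ε)) *
        ((2 + 2 * Real.log x) ^ 6 * (#q.divisors : ℝ) ^ 2) := by ring
    _ ≤ 20000 * q.totient * x ^ (-(2 * ε)) * (C * x ^ ε) := by
        exact mul_le_mul_of_nonneg_left (hbound x q hx (by lia) hqx1) (by positivity)
    _ = q.totient * (20000 * C * (x ^ (-(2 * ε)) * x ^ ε)) := by ring
    _ = _ := by
        rw [← Real.rpow_add hx0]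
        congr 3
        ring
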